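/- For $\omega\in\mathbb R\setminus\{0\}$ let \[ Q(\omega)=\frac{\tfrac14\,\log\log\pi}{|\omega|\,\bigl(1+|\omega|^2/4\pi^2\bigr)^{1/4}\,\log\bigl(\pi+|\omega|^{-1/2}\bigr)\,\bigl(\log\log(\pi+|\omega|^{-1/2})\bigr)^2}, \qquad R(x)=\frac{2\pi}{x\,\bigl(1+(x/2\pi)^{2}\bigr)\,Q(x)}, \] (the values at the single point $0$ are immaterial; set them to $0$). With the Fourier transform $\hat g(\omega)=\int_{\mathbb R}g(t)e^{-2\pi i\omega t}\,dt$, let $k(t,t')=\hat Q(t-t')$. Then the following hold. 1. $Q$ is nonnegative, even, integrable on $\mathbb R$, and strictly positive on $\mathbb R\setminus\{0\}$; $R$ is integrable on $\mathbb R$ and nonincreasing on $(0,\infty)$. 2. $k$ is a real-valued, positive semidefinite, translation invariant and universal kernel on $\mathbb R$ (universal: for every compact $K\subset\mathbb R$, finite linear combinations of the functions $k(s,\cdot)$, $s\in K$, are uniformly dense in $C(K)$), and $k(t,t)\le 8\pi^2$ for all $t\in\mathbb R$. 3. Let $\mathcal H$ be the reproducing kernel Hilbert space of real functions on $\mathbb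 R$ with kernel $k$. Every compactly supported, twice differentiable $f:\mathbb R\to\mathbb R$ with bounded $f''$ belongs to $\mathcal H$, and $\|f\|_{\mathcal H}^2=\int_{\mathbb R}|\hat f(\omega)|^2/Q(\omega)\,d\omega$. 4. There is a constant $0\le c\le(2\pi e)^2$ such that for every real $T>2$ and every twice differentiable $f:\mathbb R\to\mathbb R$ supported in $[0,T+1]$, \[ \|f\|_{\mathcal H}^2\le c^2\,\|f'\|_{L^1}\,\|f-f''\|_{L^\infty}\,\bigl(\ln(1+T)\,\ln\ln(1+T)\bigr)^2, \] and the same bound holds for $\int_{\mathbb R}|\hat f|^2/Q$ (both sides take values in $[0,\infty]$; $\|f\|_{\mathcal H}=\infty$ if $f\notin\mathcal H$). -/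

import Mathlib

open MeasureTheory
open scoped ENNReal FourierTransform

noncomputable section

/-- The explicit spectral density
`Q(ω) = (1/4) log log π / (|ω| (1 + |ω|²/4π²)^{1/4} log(π + |ω|^{-1/2}) (log log(π + |ω|^{-1/2}))²)`
(its value at the single point `ω = 0`, where the formula is singular, is immaterial). -/
def horizonFreeDensity (ω : ℝ) : ℝ :=
  (1 / 4 * Real.log (Real.log Real.pi)) /
    (|ω| * (1 + |ω| ^ 2 / (4 * Real.pi ^ 2)) ^ (1 / 4 : ℝ)
      * Real.log (Real.pi + |ω| ^ (-1 / 2 : ℝ))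
      * Real.log (Real.log (Real.pi + |ω| ^ (-1 / 2 : ℝ))) ^ 2)

/-- The function `R(x) = 2π / (x (1 + (x/2π)^{2m}) Q(x))` attached to a density `Q` and an
order `m`. -/
def densityRatio (Q : ℝ → ℝ) (m : ℕ) (x : ℝ) : ℝ :=
  2 * Real.pi / (x * (1 + (x / (2 * Real.pi)) ^ (2 * m)) * Q x)

/-- The Fourier transform `Q̂(s - t) = ∫ Q(ω) e^{-2πiω(s - t)} dω`, a priori complex valued. -/
def spectralKernelC (Q : ℝ → ℝ) (s t : ℝ) : ℂ :=
  𝓕 (fun ω : ℝ => (Q ω : ℂ)) (s - t)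

/-- The kernel with spectral density `Q` as a real-valued function. -/
def spectralKernel (Q : ℝ → ℝ) (s t : ℝ) : ℝ :=
  (spectralKernelC Q s t).re

/-- The squared norm `∫ |f̂(ω)|² / Q(ω) dω`, with value `∞` if the integral diverges. -/
def spectralNormSq (Q : ℝ → ℝ) (f : ℝ → ℝ) : ℝ≥0∞ :=
  ∫⁻ ω : ℝ, ENNReal.ofReal (‖𝓕 (fun t : ℝ => (f t : ℂ)) ω‖ ^ 2 / Q ω)

/-- Invariance of a kernel under simultaneous translation of its arguments. -/
def IsTranslationInvariant (k : ℝ → ℝ → ℝ) : Prop :=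
  ∀ s t h : ℝ, k (s + h) (t + h) = k s t

/-- Universality: on each compact `K`, every continuous function is a uniform limit of finite
linear combinations of the kernel sections `k s` with centres `s ∈ K`. -/
def IsUniversalKernel (k : ℝ → ℝ → ℝ) : Prop :=
  ∀ K : Set ℝ, IsCompact K → ∀ φ : ℝ → ℝ, ContinuousOn φ K → ∀ ε : ℝ, 0 < ε →
    ∃ a : ℝ →₀ ℝ, (a.support : Set ℝ) ⊆ K ∧
      ∀ t ∈ K, |φ t - a.sum (fun s b => b * k s t)| < ε

/-- `H` is the reproducing kernel Hilbert space of real-valued functions on `ℝ` with kernel `k`. -/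
def HasReproducingKernel (H : Type*) [NormedAddCommGroup H] [InnerProductSpace ℝ H]
    [CompleteSpace H] [RKHS ℝ H ℝ ℝ] (k : ℝ → ℝ → ℝ) : Prop :=
  ∀ s t : ℝ, RKHS.kernel H s t 1 = k s t

/-- The squared norm in `H` of a function `f : ℝ → ℝ`, with value `∞` if `f` does not belong
to `H`; the infimum ranges over at most one element. -/
def rkhsNormSq (H : Type*) [NormedAddCommGroup H] [InnerProductSpace ℝ H]
    [RKHS ℝ H ℝ ℝ] (f : ℝ → ℝ) : ℝ≥0∞ :=
  ⨅ (g : H) (_ : (⇑g : ℝ → ℝ) = f), ENNReal.ofReal (‖g‖ ^ 2)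

/-- `f` is twice differentiable on the whole line (the second derivative need not be
continuous). -/
def TwiceDifferentiable (f : ℝ → ℝ) : Prop :=
  Differentiable ℝ f ∧ Differentiable ℝ (deriv f)

end

/-!
Put `cas x = cos x + sin x`. Since `cas u * cas v = cos (u - v) + sin (u + v)` and `Q` is even, the
functions `ω ↦ √(Q ω) * cas (2πtω)` form a feature map in `L²(ℝ)` for the kernel `𝓕 Q (s - t)`. A
function `f` is represented by the vector `h / √Q`, where `h` is the Hartley transform of `f`; its
squared norm is `∫ h² / Q = ∫ |𝓕 f|² / Q`. The span of the features is dense, so that this vector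
is the only one representing `f`: the RKHS norm is the spectral norm, and universality follows by
approximating continuous functions by smooth compactly supported ones.

For the bound, integrate by parts: `2π ∫ |𝓕 f|² / Q` is the bilinear form
`∫∫ (f - f'')(s) f'(t) 𝓢V(s - t)`, where `𝓢V` is the sine transform of the odd dual weight
`V ω = 1 / (ω (1 + 4π²ω²) Q ω)`. As `V` decreases on `(0, ∞)`, `𝓢V` is nonnegative there, so its
`L¹` norm on `[-a, a]` is an explicit integral of `V` against `(1 - cos 2πaω) / (2πω)`. For the
given density this integral is of order `(log a * log log a)²`, the main contribution coming from
frequencies between `1 / a` and `1`.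
-/

open Filter Function Real Set Topology

/-! ### Feature maps and reproducing kernels -/

section FeatureMap

variable {X E : Type*} [NormedAddCommGroup E] [InnerProductSpace ℝ E]

lemma inner_linearCombination (φ : X → E) (a : X →₀ ℝ) (u : E) :
    inner ℝ (Finsupp.linearCombination ℝ φ a) u = a.sum fun s b ↦ b * inner ℝ (φ s) u := by
  simp only [Finsupp.linearCombination_apply, Finsupp.sum, sum_inner, real_inner_smul_left]

lemma posSemidef_gram (φ : X → E) : (Matrix.gram ℝ φ).PosSemidef := by
  refine ⟨Matrix.isHermitian_gram ℝ φ, fun a ↦ ?_⟩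
  calc 0 ≤ inner ℝ (Finsupp.linearCombination ℝ φ a) (Finsupp.linearCombination ℝ φ a) :=
        real_inner_self_nonneg
    _ = _ := by
        simp only [inner_linearCombination, real_inner_comm (Finsupp.linearCombination ℝ φ a),
          Matrix.gram_apply, star_trivial, Finsupp.sum, Finset.mul_sum]
        refine Finset.sum_congr rfl fun s _ ↦ Finset.sum_congr rfl fun t _ ↦ ?_
        rw [real_inner_comm]
        ring

/-- If `u` represents `f` on `K`, then so does its projection to the closed span of `φ '' K`, and
that projection is a limit of linear combinations. -/
lemma exists_finsupp_abs_inner_sub_lt [CompleteSpace E] {φ : X → E} {K : Set X} {M : ℝ}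
    (hM : ∀ t ∈ K, ‖φ t‖ ≤ M) (u : E) {ε : ℝ} (hε : 0 < ε) :
    ∃ a : X →₀ ℝ, (a.support : Set X) ⊆ K ∧
      ∀ t ∈ K, |inner ℝ u (φ t) - a.sum fun s b ↦ b * inner ℝ (φ s) (φ t)| < ε := by
  let W := (Submodule.span ℝ (φ '' K)).topologicalClosure
  have : CompleteSpace W := (Submodule.isClosed_topologicalClosure _).completeSpace_coe
  obtain ⟨_, hmem, hdist⟩ := Metric.mem_closure_iff.1 (W.starProjection_apply_mem u)
    (ε / (|M| + 1)) (by positivity)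
  obtain ⟨a, haK, rfl⟩ := (Finsupp.mem_span_image_iff_linearCombination ℝ).1 hmem
  refine ⟨a, haK, fun t ht ↦ ?_⟩
  have hproj : inner ℝ u (φ t) = inner ℝ (W.starProjection u) (φ t) := by
    have horth := W.starProjection_inner_eq_zero u (φ t)
      (Submodule.le_topologicalClosure _ (Submodule.subset_span ⟨t, ht, rfl⟩))
    rwa [inner_sub_left, sub_eq_zero] at horth
  rw [hproj, ← inner_linearCombination, ← inner_sub_left]
  calc _ ≤ ‖W.starProjection u - Finsupp.linearCombination ℝ φ a‖ * ‖φ t‖ :=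
        abs_real_inner_le_norm _ _
    _ ≤ ‖W.starProjection u - Finsupp.linearCombination ℝ φ a‖ * (|M| + 1) := by
        gcongr
        linarith [hM t ht, le_abs_self M]
    _ < ε := by rwa [← lt_div_iff₀ (by positivity), ← dist_eq_norm]

variable {H : Type*} [NormedAddCommGroup H] [InnerProductSpace ℝ H]
  [CompleteSpace H] [RKHS ℝ H X ℝ]

lemma exists_rkhs_eq_inner {φ : X → E}
    (hdense : (Submodule.span ℝ (range φ)).topologicalClosure = ⊤)
    (hker : ∀ s t, RKHS.kernel H s t 1 = inner ℝ (φ s) (φ t)) (u : E) :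
    ∃ g : H, (∀ t, g t = inner ℝ u (φ t)) ∧ ‖g‖ = ‖u‖ := by
  let A := Finsupp.linearCombination ℝ φ
  let B := Finsupp.linearCombination ℝ fun s ↦ RKHS.kerFun H s (1 : ℝ)
  have hA : DenseRange A := by
    rw [← Finsupp.range_linearCombination] at hdense
    exact Submodule.dense_iff_topologicalClosure_eq_top.2 hdense
  have hinner (a b) : inner ℝ (B a) (B b) = inner ℝ (A a) (A b) := by
    simp only [A, B, Finsupp.linearCombination_apply, Finsupp.sum, sum_inner, inner_sum,
      real_inner_smul_left, real_inner_smul_right, RKHS.kerFun_inner, RKHS.kerFun_apply, hker,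
      RCLike.inner_apply, map_one, mul_one]
  have hnorm (a) : ‖B a‖ = ‖A a‖ := by simp only [norm_eq_sqrt_real_inner, hinner]
  have hext (a) : B.extendOfNorm A (A a) = B a :=
    LinearMap.extendOfNorm_eq hA ⟨1, fun a ↦ by rw [hnorm, one_mul]⟩ a
  refine ⟨B.extendOfNorm A u, fun t ↦ ?_, ?_⟩
  · refine hA.induction_on (p := fun u ↦ B.extendOfNorm A u t = inner ℝ u (φ t)) u
      (isClosed_eq ((RKHS.continuous_eval t).comp (map_continuous _)) (by fun_prop)) fun a ↦ ?_
    rw [hext]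
    have hB : RKHS.kerFun H t (1 : ℝ) = B (Finsupp.single t 1) := by simp [B]
    have hA : φ t = A (Finsupp.single t 1) := by simp [A]
    rw [hA, ← hinner, ← hB, RKHS.inner_kerFun]
    simp
  · refine hA.induction_on (p := fun u ↦ ‖B.extendOfNorm A u‖ = ‖u‖) u
      (isClosed_eq (by fun_prop) (by fun_prop)) fun a ↦ ?_
    rw [hext, hnorm]

end FeatureMap

lemma exists_contDiff_hasCompactSupport_dist_lt {E : Type*}
    [NormedAddCommGroup E] [NormedSpace ℝ E] [FiniteDimensional ℝ E] {K : Set E}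
    (hK : IsCompact K) {φ : E → ℝ} (hφ : ContinuousOn φ K) (n : ℕ∞) {ε : ℝ} (hε : 0 < ε) :
    ∃ f : E → ℝ, ContDiff ℝ n f ∧ HasCompactSupport f ∧ ∀ t ∈ K, dist (f t) (φ t) < ε := by
  obtain ⟨ψ, hψ⟩ := ContinuousMap.exists_restrict_eq hK.isClosed ⟨K.domRestrict φ, hφ.domRestrict⟩
  obtain ⟨χ, hχK, -, hχ, -⟩ :=
    exists_continuous_one_zero_of_isCompact hK isClosed_empty (disjoint_empty K)
  obtain ⟨f, hf, hfdist, hfsupp⟩ := (χ.continuous.mul ψ.continuous).exists_contDiff_approx n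
    continuous_const fun _ ↦ hε
  refine ⟨f, hf, hχ.mul_right.mono' (hfsupp.trans subset_closure), fun t ht ↦ ?_⟩
  have hψt : ψ t = φ t := DFunLike.congr_fun hψ ⟨t, ht⟩
  simpa [hψt, hχK ht] using hfdist t

lemma integral_eq_zero_of_odd {G E : Type*} [MeasurableSpace G] [AddGroup G] [MeasurableNeg G]
    [NormedAddCommGroup E] [NormedSpace ℝ E] {μ : Measure G} [μ.IsNegInvariant] {f : G → E}
    (hf : f.Odd) : ∫ x, f x ∂μ = 0 := by
  have hneg := integral_neg_eq_self f μ
  simp only [hf.eq, integral_neg] at hneg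
  have hdouble : (2 : ℝ) • ∫ x, f x ∂μ = 0 := by rw [two_smul, ← neg_eq_iff_add_eq_zero, hneg]
  exact (smul_eq_zero.1 hdouble).resolve_left two_ne_zero

lemma ae_eq_zero_of_fourier_eq_zero {V E : Type*} [NormedAddCommGroup V] [InnerProductSpace ℝ V]
    [FiniteDimensional ℝ V] [MeasurableSpace V] [BorelSpace V] [NormedAddCommGroup E]
    [NormedSpace ℂ E] [CompleteSpace E] {f : V → E} (hf : Integrable f)
    (hzero : ∀ w, 𝓕 f w = 0) : ∀ᵐ x, f x = 0 := by
  refine ae_eq_zero_of_integral_contDiff_smul_eq_zero hf.locallyIntegrable fun g hg hgc ↦ ?_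
  let G : SchwartzMap V ℂ :=
    (hgc.comp_left (g := Complex.ofReal) rfl).toSchwartzMap (Complex.ofRealCLM.contDiff.comp hg)
  have hG : 𝓕 (⇑(𝓕⁻ G : SchwartzMap V ℂ)) = fun x ↦ (g x : ℂ) := by
    rw [← SchwartzMap.fourier_coe, FourierTransform.fourier_fourierInv_eq]
    rfl
  have hflip : ∫ ξ, 𝓕 (⇑(𝓕⁻ G : SchwartzMap V ℂ)) ξ • f ξ =
      ∫ x, (𝓕⁻ G : SchwartzMap V ℂ) x • 𝓕 f x := by
    have hadj := VectorFourier.integral_fourierIntegral_smul_eq_flip (L := innerₗ V)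
      continuous_fourierChar continuous_inner
      ((𝓕⁻ G : SchwartzMap V ℂ).integrable (μ := volume)) hf
    rwa [flip_innerₗ] at hadj
  simpa only [hG, hzero, smul_zero, integral_zero, Complex.coe_smul] using hflip

/-! ### The Hartley transform -/

section Cas

/-- The Hartley kernel. -/
noncomputable def cas (x : ℝ) : ℝ := cos x + sin x

@[fun_prop]
lemma continuous_cas : Continuous cas := by unfold cas; fun_prop

lemma abs_cas_le (x : ℝ) : |cas x| ≤ 2 :=
  (abs_add_le _ _).trans (by linarith [abs_cos_le_one x, abs_sin_le_one x])

lemma cas_mul_cas (x y : ℝ) : cas x * cas y = cos (x - y) + sin (x + y) := by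
  rw [cos_sub, sin_add, cas, cas]
  ring

end Cas

section HartleyTransform

variable {f : ℝ → ℝ}

lemma integrable_mul_cos (hf : Integrable f) (c : ℝ) : Integrable fun t ↦ f t * cos (c * t) :=
  hf.mul_bdd (by fun_prop) (.of_forall fun _ ↦ abs_cos_le_one _)

lemma integrable_mul_sin (hf : Integrable f) (c : ℝ) : Integrable fun t ↦ f t * sin (c * t) :=
  hf.mul_bdd (by fun_prop) (.of_forall fun _ ↦ abs_sin_le_one _)

lemma integrable_mul_cas (hf : Integrable f) (c : ℝ) : Integrable fun t ↦ f t * cas (c * t) :=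
  hf.mul_bdd (by fun_prop) (.of_forall fun _ ↦ abs_cas_le _)

lemma continuous_fourier_ofReal (hf : Integrable f) : Continuous (𝓕 fun t ↦ (f t : ℂ)) :=
  VectorFourier.fourierIntegral_continuous continuous_fourierChar continuous_inner hf.ofReal

lemma integrable_exp_smul_ofReal (hf : Integrable f) (ω : ℝ) :
    Integrable fun t : ℝ ↦ Complex.exp (↑(-2 * π * t * ω) * Complex.I) • (f t : ℂ) :=
  hf.ofReal.bdd_mul (by fun_prop) (.of_forall fun _ ↦ (Complex.norm_exp_ofReal_mul_I _).le)

lemma fourier_ofReal_re (hf : Integrable f) (ω : ℝ) :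
    (𝓕 (fun t ↦ (f t : ℂ)) ω).re = ∫ t, f t * cos (2 * π * ω * t) := by
  rw [fourier_real_eq_integral_exp_smul]
  refine (integral_re (integrable_exp_smul_ofReal hf ω)).symm.trans
    (integral_congr_ae <| .of_forall fun t ↦ ?_)
  have harg : -2 * π * t * ω = -(2 * π * ω * t) := by ring
  simp only [harg, smul_eq_mul, RCLike.re_to_complex, Complex.re_mul_ofReal,
    Complex.exp_ofReal_mul_I_re, cos_neg]
  ring

lemma fourier_ofReal_im (hf : Integrable f) (ω : ℝ) :
    (𝓕 (fun t ↦ (f t : ℂ)) ω).im = -∫ t, f t * sin (2 * π * ω * t) := by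
  rw [fourier_real_eq_integral_exp_smul, ← integral_neg]
  refine (integral_im (integrable_exp_smul_ofReal hf ω)).symm.trans
    (integral_congr_ae <| .of_forall fun t ↦ ?_)
  have harg : -2 * π * t * ω = -(2 * π * ω * t) := by ring
  simp only [harg, smul_eq_mul, RCLike.im_to_complex, Complex.im_mul_ofReal,
    Complex.exp_ofReal_mul_I_im, sin_neg]
  ring

/-- The Hartley transform, the real form of the Fourier transform. -/
noncomputable def hartleyTransform (f : ℝ → ℝ) (ω : ℝ) : ℝ := ∫ t, f t * cas (2 * π * ω * t)

lemma hartleyTransform_eq_re_sub_im (hf : Integrable f) (ω : ℝ) :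
    hartleyTransform f ω = (𝓕 (fun t ↦ (f t : ℂ)) ω).re - (𝓕 (fun t ↦ (f t : ℂ)) ω).im := by
  rw [fourier_ofReal_re hf, fourier_ofReal_im hf, sub_neg_eq_add,
    ← integral_add (integrable_mul_cos hf _) (integrable_mul_sin hf _)]
  simp only [hartleyTransform, cas, mul_add]

lemma hartleyTransform_neg_eq_re_add_im (hf : Integrable f) (ω : ℝ) :
    hartleyTransform f (-ω) = (𝓕 (fun t ↦ (f t : ℂ)) ω).re + (𝓕 (fun t ↦ (f t : ℂ)) ω).im := by
  simp only [hartleyTransform_eq_re_sub_im hf, fourier_ofReal_re hf, fourier_ofReal_im hf, mul_neg,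
    neg_mul, cos_neg, sin_neg, integral_neg, sub_eq_add_neg, neg_neg]

lemma continuous_hartleyTransform (hf : Integrable f) : Continuous (hartleyTransform f) := by
  have hcont := continuous_fourier_ofReal hf
  rw [funext (hartleyTransform_eq_re_sub_im hf)]
  fun_prop

lemma norm_fourier_ofReal_sq (hf : Integrable f) (ω : ℝ) :
    ‖𝓕 (fun t ↦ (f t : ℂ)) ω‖ ^ 2 =
      (hartleyTransform f ω ^ 2 + hartleyTransform f (-ω) ^ 2) / 2 := by
  rw [hartleyTransform_eq_re_sub_im hf, hartleyTransform_neg_eq_re_add_im hf, Complex.sq_norm,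
    Complex.normSq_apply]
  ring

lemma ae_eq_zero_of_hartleyTransform_eq_zero (hf : Integrable f)
    (hzero : ∀ ω, hartleyTransform f ω = 0) : ∀ᵐ t, f t = 0 := by
  have hfourier (ω) : 𝓕 (fun t ↦ (f t : ℂ)) ω = 0 := by
    rw [← norm_eq_zero, ← sq_eq_zero_iff, norm_fourier_ofReal_sq hf, hzero, hzero]
    norm_num
  simpa using ae_eq_zero_of_fourier_eq_zero hf.ofReal hfourier

lemma integrable_fourier_ofReal (hf : Integrable f) (hhf : Integrable (hartleyTransform f)) :
    Integrable (𝓕 fun t ↦ (f t : ℂ)) := by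
  refine (hhf.norm.add hhf.comp_neg.norm).mono'
    (continuous_fourier_ofReal hf).aestronglyMeasurable (.of_forall fun ω ↦ ?_)
  rw [Pi.add_apply, Real.norm_eq_abs, Real.norm_eq_abs]
  refine le_of_sq_le_sq ?_ (by positivity)
  rw [norm_fourier_ofReal_sq hf,
    ← sq_abs (hartleyTransform f ω), ← sq_abs (hartleyTransform f (-ω))]
  nlinarith [abs_nonneg (hartleyTransform f ω), abs_nonneg (hartleyTransform f (-ω))]

lemma integral_hartleyTransform_mul_cas (hfc : Continuous f) (hf : Integrable f)
    (hhf : Integrable (hartleyTransform f)) (t : ℝ) :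
    ∫ ω, hartleyTransform f ω * cas (2 * π * t * ω) = f t := by
  have hF := integrable_fourier_ofReal hf hhf
  have hinv : (𝓕⁻ (𝓕 fun t ↦ (f t : ℂ)) t).re = f t := by
    have hfC : Continuous fun t ↦ (f t : ℂ) := by fun_prop
    rw [hfC.fourierInv_fourier_eq hf.ofReal hF, Complex.ofReal_re]
  have hexp : Integrable fun ω : ℝ ↦
      Complex.exp (↑(2 * π * inner ℝ ω t) * Complex.I) • 𝓕 (fun t ↦ (f t : ℂ)) ω :=
    hF.bdd_mul (by fun_prop) (.of_forall fun _ ↦ (Complex.norm_exp_ofReal_mul_I _).le)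
  have hcas := integrable_mul_cas hhf (2 * π * t)
  rw [fourierInv_eq', ← RCLike.re_to_complex,
    ← integral_re hexp] at hinv
  rw [← hinv]
  calc ∫ ω, hartleyTransform f ω * cas (2 * π * t * ω)
      = (∫ ω, hartleyTransform f ω * cas (2 * π * t * ω) +
          hartleyTransform f (-ω) * cas (2 * π * t * -ω)) / 2 := by
        rw [integral_add hcas hcas.comp_neg,
          integral_neg_eq_self fun ω ↦ hartleyTransform f ω * cas (2 * π * t * ω)]
        ring
    _ = _ := by
        rw [← integral_div]
        refine integral_congr_ae <| .of_forall fun ω ↦ ?_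
        beta_reduce
        rw [hartleyTransform_eq_re_sub_im hf, hartleyTransform_neg_eq_re_add_im hf]
        have harg : 2 * π * inner ℝ ω t = 2 * π * t * ω := by simp; ring
        simp only [harg, cas, mul_neg, cos_neg, sin_neg, smul_eq_mul, RCLike.re_to_complex,
          Complex.mul_re, Complex.exp_ofReal_mul_I_re, Complex.exp_ofReal_mul_I_im]
        ring

end HartleyTransform

/-! ### Kernels with a spectral density -/

/-- An even integrable function that is positive off the origin, the density of a symmetric
spectral measure. -/
structure IsSpectralDensity (Q : ℝ → ℝ) : Prop where
  integrable : Integrable Q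
  even : Q.Even
  nonneg : ∀ ω, 0 ≤ Q ω
  pos : ∀ ω, ω ≠ 0 → 0 < Q ω

lemma isTranslationInvariant_spectralKernel (Q : ℝ → ℝ) :
    IsTranslationInvariant (spectralKernel Q) := by
  intro s t h
  simp [spectralKernel, spectralKernelC]

namespace IsSpectralDensity

variable {Q : ℝ → ℝ}

lemma ae_pos (hQ : IsSpectralDensity Q) : ∀ᵐ ω, 0 < Q ω := by
  filter_upwards [Measure.ae_ne volume (0 : ℝ)] with ω hω using hQ.pos ω hω

lemma memLp_sqrt (hQ : IsSpectralDensity Q) : MemLp (fun ω ↦ √(Q ω)) 2 := by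
  have hmeas := continuous_sqrt.comp_aestronglyMeasurable hQ.integrable.aestronglyMeasurable
  rw [memLp_two_iff_integrable_sq hmeas]
  simpa only [sq_sqrt (hQ.nonneg _)] using hQ.integrable

lemma memLp_sqrt_mul_cas (hQ : IsSpectralDensity Q) (t : ℝ) :
    MemLp (fun ω ↦ √(Q ω) * cas (2 * π * t * ω)) 2 :=
  hQ.memLp_sqrt.of_le_mul (c := 2) (hQ.memLp_sqrt.aestronglyMeasurable.mul (by fun_prop)) <|
    .of_forall fun ω ↦ by
      rw [norm_mul, mul_comm]
      exact mul_le_mul_of_nonneg_right (abs_cas_le _) (norm_nonneg _)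

/-- The feature map `t ↦ √Q · cas (2πt ·)` into the real space `L²(ℝ)` of the kernel with
spectral density `Q`. The Hartley kernel replaces the exponential to keep the features real. -/
noncomputable def feature (hQ : IsSpectralDensity Q) (t : ℝ) : Lp ℝ 2 (volume : Measure ℝ) :=
  (hQ.memLp_sqrt_mul_cas t).toLp

lemma inner_feature_right (hQ : IsSpectralDensity Q) (u : Lp ℝ 2 (volume : Measure ℝ)) (t : ℝ) :
    inner ℝ u (hQ.feature t) = hartleyTransform (fun ω ↦ u ω * √(Q ω)) t := by
  rw [L2.inner_def]
  refine integral_congr_ae ?_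
  filter_upwards [(hQ.memLp_sqrt_mul_cas t).coeFn_toLp] with ω hω
  rw [feature, hω, real_inner_comm]
  exact (mul_assoc _ _ _).symm

lemma spectralKernel_eq_integral_cos (hQ : IsSpectralDensity Q) (s t : ℝ) :
    spectralKernel Q s t = ∫ ω, Q ω * cos (2 * π * (s - t) * ω) :=
  fourier_ofReal_re hQ.integrable _

lemma integral_mul_sin_eq_zero (hQ : IsSpectralDensity Q) (c : ℝ) :
    ∫ ω, Q ω * sin (c * ω) = 0 :=
  integral_eq_zero_of_odd fun ω ↦ by simp [hQ.even ω]

lemma spectralKernelC_im (hQ : IsSpectralDensity Q) (s t : ℝ) :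
    (spectralKernelC Q s t).im = 0 := by
  rw [spectralKernelC, fourier_ofReal_im hQ.integrable, hQ.integral_mul_sin_eq_zero, neg_zero]

lemma inner_feature (hQ : IsSpectralDensity Q) (s t : ℝ) :
    inner ℝ (hQ.feature s) (hQ.feature t) = spectralKernel Q s t := by
  calc inner ℝ (hQ.feature s) (hQ.feature t)
      = ∫ ω, Q ω * cos (2 * π * (s - t) * ω) + Q ω * sin (2 * π * (s + t) * ω) := by
        rw [inner_feature_right]
        refine integral_congr_ae ?_
        filter_upwards [(hQ.memLp_sqrt_mul_cas s).coeFn_toLp] with ω hω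
        have hcas := cas_mul_cas (2 * π * s * ω) (2 * π * t * ω)
        rw [← sub_mul, ← mul_sub, ← add_mul, ← mul_add] at hcas
        rw [feature, hω, ← mul_add, ← hcas]
        linear_combination
          cas (2 * π * s * ω) * cas (2 * π * t * ω) * mul_self_sqrt (hQ.nonneg ω)
    _ = spectralKernel Q s t := by
        rw [integral_add (integrable_mul_cos hQ.integrable _) (integrable_mul_sin hQ.integrable _),
          hQ.integral_mul_sin_eq_zero, add_zero, hQ.spectralKernel_eq_integral_cos]

lemma posSemidef (hQ : IsSpectralDensity Q) : (Matrix.of (spectralKernel Q)).PosSemidef := by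
  convert posSemidef_gram hQ.feature using 1
  ext s t
  exact (hQ.inner_feature s t).symm

lemma spectralKernel_self (hQ : IsSpectralDensity Q) (t : ℝ) :
    spectralKernel Q t t = ∫ ω, Q ω := by
  simp [hQ.spectralKernel_eq_integral_cos]

lemma norm_feature_sq (hQ : IsSpectralDensity Q) (t : ℝ) : ‖hQ.feature t‖ ^ 2 = ∫ ω, Q ω := by
  rw [← real_inner_self_eq_norm_sq, hQ.inner_feature, hQ.spectralKernel_self]

lemma topologicalClosure_span_feature (hQ : IsSpectralDensity Q) :
    (Submodule.span ℝ (range hQ.feature)).topologicalClosure = ⊤ := by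
  rw [Submodule.topologicalClosure_eq_top_iff, Submodule.eq_bot_iff]
  intro w hw
  have hint : Integrable fun ω ↦ w ω * √(Q ω) := (Lp.memLp w).integrable_mul hQ.memLp_sqrt
  have hzero := ae_eq_zero_of_hartleyTransform_eq_zero hint fun t ↦ by
    rw [← hQ.inner_feature_right]
    exact (Submodule.mem_orthogonal' _ _).1 hw _ (Submodule.subset_span ⟨t, rfl⟩)
  rw [Lp.eq_zero_iff_ae_eq_zero]
  filter_upwards [hzero, hQ.ae_pos] with ω hω hpos
  exact (mul_eq_zero.1 hω).resolve_right (sqrt_pos.2 hpos).ne'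

lemma spectralNormSq_eq_lintegral_hartleyTransform (hQ : IsSpectralDensity Q) {f : ℝ → ℝ}
    (hf : Integrable f) :
    spectralNormSq Q f = ∫⁻ ω, ENNReal.ofReal (hartleyTransform f ω ^ 2 / Q ω) := by
  have hmeas : AEMeasurable fun ω ↦ ENNReal.ofReal (hartleyTransform f ω ^ 2 / Q ω / 2) :=
    ((((continuous_hartleyTransform hf).pow 2).aemeasurable.div
      hQ.integrable.aemeasurable).div_const 2).ennreal_ofReal
  have hnonneg (ω) : 0 ≤ hartleyTransform f ω ^ 2 / Q ω / 2 :=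
    div_nonneg (div_nonneg (sq_nonneg _) (hQ.nonneg ω)) zero_le_two
  calc spectralNormSq Q f
      = ∫⁻ ω, (ENNReal.ofReal (hartleyTransform f ω ^ 2 / Q ω / 2) +
          ENNReal.ofReal (hartleyTransform f (-ω) ^ 2 / Q (-ω) / 2)) := by
        refine lintegral_congr fun ω ↦ ?_
        rw [← ENNReal.ofReal_add (hnonneg ω) (hnonneg (-ω)), norm_fourier_ofReal_sq hf, hQ.even]
        congr 1
        ring
    _ = ∫⁻ ω, (ENNReal.ofReal (hartleyTransform f ω ^ 2 / Q ω / 2) +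
          ENNReal.ofReal (hartleyTransform f ω ^ 2 / Q ω / 2)) := by
        rw [lintegral_add_left' hmeas, lintegral_add_left' hmeas,
          lintegral_neg_eq_self fun ω ↦ ENNReal.ofReal (hartleyTransform f ω ^ 2 / Q ω / 2)]
    _ = _ := by
        refine lintegral_congr fun ω ↦ ?_
        rw [← ENNReal.ofReal_add (hnonneg ω) (hnonneg ω), add_halves]

/-- The vector is `hartleyTransform f / √Q`: its pairing with the features is Hartley inversion. -/
lemma exists_forall_inner_feature_eq (hQ : IsSpectralDensity Q) {f : ℝ → ℝ} (hfc : Continuous f)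
    (hf : Integrable f) (hfin : spectralNormSq Q f ≠ ∞) :
    ∃ u : Lp ℝ 2 (volume : Measure ℝ), (∀ t, inner ℝ u (hQ.feature t) = f t) ∧
      ENNReal.ofReal (‖u‖ ^ 2) = spectralNormSq Q f := by
  rw [hQ.spectralNormSq_eq_lintegral_hartleyTransform hf] at hfin ⊢
  have hmeas : AEStronglyMeasurable fun ω ↦ hartleyTransform f ω / √(Q ω) :=
    (continuous_hartleyTransform hf).aestronglyMeasurable.div₀ hQ.memLp_sqrt.aestronglyMeasurable
  have hsq (ω) : (hartleyTransform f ω / √(Q ω)) ^ 2 = hartleyTransform f ω ^ 2 / Q ω := by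
    rw [div_pow, sq_sqrt (hQ.nonneg ω)]
  have hnonneg (ω) : 0 ≤ hartleyTransform f ω ^ 2 / Q ω := div_nonneg (sq_nonneg _) (hQ.nonneg ω)
  have hsqint : Integrable fun ω ↦ (hartleyTransform f ω / √(Q ω)) ^ 2 := by
    refine (lintegral_ofReal_ne_top_iff_integrable (hmeas.pow 2)
      (.of_forall fun ω ↦ sq_nonneg _)).1 ?_
    simpa only [Pi.pow_apply, hsq] using hfin
  have hu := (memLp_two_iff_integrable_sq hmeas).2 hsqint
  have hcancel : (fun ω ↦ hartleyTransform f ω / √(Q ω) * √(Q ω)) =ᵐ[volume]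
      hartleyTransform f := by
    filter_upwards [hQ.ae_pos] with ω hω using div_mul_cancel₀ _ (sqrt_pos.2 hω).ne'
  have hhf : Integrable (hartleyTransform f) := (hu.integrable_mul hQ.memLp_sqrt).congr hcancel
  refine ⟨hu.toLp, fun t ↦ ?_, ?_⟩
  · rw [hQ.inner_feature_right, ← integral_hartleyTransform_mul_cas hfc hf hhf]
    refine integral_congr_ae ?_
    filter_upwards [hu.coeFn_toLp, hcancel] with ω hω hcancelω
    rw [hω, hcancelω]
  · rw [← real_inner_self_eq_norm_sq, L2.inner_def, ← ofReal_integral_eq_lintegral_ofReal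
      (by simpa only [hsq] using hsqint) (.of_forall hnonneg)]
    congr 1
    refine integral_congr_ae ?_
    filter_upwards [hu.coeFn_toLp] with ω hω
    rw [hω, real_inner_self_eq_norm_sq, norm_eq_abs, sq_abs, hsq]

lemma exists_rkhs_norm_eq (hQ : IsSpectralDensity Q) {f : ℝ → ℝ} (hfc : Continuous f)
    (hf : Integrable f) (hfin : spectralNormSq Q f ≠ ∞) {H : Type*} [NormedAddCommGroup H]
    [InnerProductSpace ℝ H] [CompleteSpace H] [RKHS ℝ H ℝ ℝ]
    (hH : HasReproducingKernel H (spectralKernel Q)) :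
    ∃ g : H, (⇑g : ℝ → ℝ) = f ∧ ENNReal.ofReal (‖g‖ ^ 2) = spectralNormSq Q f := by
  obtain ⟨u, hu, hnorm⟩ := hQ.exists_forall_inner_feature_eq hfc hf hfin
  obtain ⟨g, hg, hgnorm⟩ := exists_rkhs_eq_inner (H := H) hQ.topologicalClosure_span_feature
    (fun s t ↦ by rw [hH, hQ.inner_feature]) u
  exact ⟨g, funext fun t ↦ (hg t).trans (hu t), by rw [hgnorm, hnorm]⟩

lemma rkhsNormSq_le_spectralNormSq (hQ : IsSpectralDensity Q) {f : ℝ → ℝ} (hfc : Continuous f)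
    (hf : Integrable f) {H : Type*} [NormedAddCommGroup H] [InnerProductSpace ℝ H]
    [CompleteSpace H] [RKHS ℝ H ℝ ℝ] (hH : HasReproducingKernel H (spectralKernel Q)) :
    rkhsNormSq H f ≤ spectralNormSq Q f := by
  by_cases hfin : spectralNormSq Q f = ∞
  · exact hfin ▸ le_top
  · obtain ⟨g, hg, hnorm⟩ := hQ.exists_rkhs_norm_eq hfc hf hfin hH
    exact (iInf₂_le g hg).trans hnorm.le

lemma isUniversalKernel (hQ : IsSpectralDensity Q) {n : ℕ∞}
    (hfin : ∀ f : ℝ → ℝ, ContDiff ℝ n f → HasCompactSupport f → spectralNormSq Q f ≠ ∞) :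
    IsUniversalKernel (spectralKernel Q) := by
  intro K hK φ hφ ε hε
  obtain ⟨f, hf, hfsupp, hfφ⟩ :=
    exists_contDiff_hasCompactSupport_dist_lt hK hφ n (half_pos hε)
  obtain ⟨u, hu, -⟩ := hQ.exists_forall_inner_feature_eq hf.continuous
    (hf.continuous.integrable_of_hasCompactSupport hfsupp) (hfin f hf hfsupp)
  have hbound : ∀ t ∈ K, ‖hQ.feature t‖ ≤ √(∫ ω, Q ω) := fun t _ ↦
    le_sqrt_of_sq_le (hQ.norm_feature_sq t).le
  obtain ⟨a, haK, ha⟩ := exists_finsupp_abs_inner_sub_lt hbound u (half_pos hε)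
  refine ⟨a, haK, fun t ht ↦ ?_⟩
  specialize ha t ht
  simp only [hu, hQ.inner_feature] at ha
  calc _ ≤ |φ t - f t| + |f t - a.sum fun s b ↦ b * spectralKernel Q s t| := abs_sub_le _ _ _
    _ < ε / 2 + ε / 2 := add_lt_add (by simpa [dist_comm, dist_eq] using hfφ t ht) ha
    _ = ε := add_halves ε

end IsSpectralDensity

/-! ### The sine transform of a function decreasing on the half line -/

/-- The sine transform of `V` over the whole line. -/
noncomputable def sineTransform (V : ℝ → ℝ) (z : ℝ) : ℝ :=
  ∫ ω, V ω * sin (2 * π * z * ω)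

/-- The primitive `a ↦ ∫₀ᵃ sin(2πzω) dz`, with the correct value `0` at `ω = 0` because
`x / 0 = 0`. -/
noncomputable def sinePrimitive (a ω : ℝ) : ℝ :=
  (1 - cos (2 * π * a * ω)) / (2 * π * ω)

section SineTransform

variable {V : ℝ → ℝ}

@[simp]
lemma sineTransform_zero (V : ℝ → ℝ) : sineTransform V 0 = 0 := by
  simp [sineTransform]

lemma sineTransform_neg (V : ℝ → ℝ) (z : ℝ) : sineTransform V (-z) = -sineTransform V z := by
  simp [sineTransform, integral_neg]

lemma continuous_sineTransform (hV : Integrable V) : Continuous (sineTransform V) := by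
  have him : sineTransform V = fun z ↦ -(𝓕 (fun t ↦ (V t : ℂ)) z).im := by
    ext z
    rw [fourier_ofReal_im hV, neg_neg, sineTransform]
  have := continuous_fourier_ofReal hV
  rw [him]
  fun_prop

lemma sineTransform_eq_two_mul (hodd : V.Odd) (z : ℝ) :
    sineTransform V z = 2 * ∫ ω in Ioi 0, V ω * sin (2 * π * z * ω) := by
  rw [← integral_comp_abs (f := fun ω ↦ V ω * sin (2 * π * z * ω)), sineTransform]
  congr! 2 with ω
  rcases abs_choice ω with h | h <;> simp [h, hodd ω]

lemma intervalIntegral_mul_nonneg_of_antiperiodic {s : ℝ → ℝ} {a h : ℝ} (hh : 0 ≤ h)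
    (hV : AntitoneOn V (Ioo a (a + 2 * h))) (hs : Antiperiodic s h)
    (hs_nonneg : ∀ x ∈ Ioo a (a + h), 0 ≤ s x)
    (hint : ∀ b c, IntervalIntegrable (fun x ↦ V x * s x) volume b c) :
    0 ≤ ∫ x in a..(a + 2 * h), V x * s x := by
  rw [← intervalIntegral.integral_add_adjacent_intervals (hint a (a + h)) (hint _ _), two_mul,
    ← add_assoc, ← intervalIntegral.integral_comp_add_right (fun x ↦ V x * s x) h,
    ← intervalIntegral.integral_add (hint _ _)
      (by simpa using (hint (a + h) (a + h + h)).comp_add_right h)]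
  refine intervalIntegral.integral_nonneg_of_ae_restrict (by linarith) ?_
  rw [← restrict_Ioo_eq_restrict_Icc]
  filter_upwards [ae_restrict_mem measurableSet_Ioo] with x hx
  have hfold : V x * s x + V (x + h) * s (x + h) = (V x - V (x + h)) * s x := by
    rw [hs x]
    ring
  rw [Pi.zero_apply, hfold]
  refine mul_nonneg (sub_nonneg.2 (hV ?_ ?_ (by linarith))) (hs_nonneg x hx) <;>
    constructor <;> linarith [hx.1, hx.2]

lemma integral_Ioi_mul_sin_nonneg (hV : Integrable V) (hanti : AntitoneOn V (Ioi 0))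
    {c : ℝ} (hc : 0 < c) : 0 ≤ ∫ ω in Ioi 0, V ω * sin (c * ω) := by
  set h := c⁻¹ * π
  have hh : 0 < h := by positivity
  have hF : Integrable fun ω ↦ V ω * sin (c * ω) := integrable_mul_sin hV c
  have hanti_sin : Antiperiodic (fun ω ↦ sin (c * ω)) h := sin_antiperiodic.const_mul hc.ne'
  have hperiod (k : ℕ) : 0 ≤ ∫ ω in (2 * h * k)..(2 * h * (k + 1 : ℕ)), V ω * sin (c * ω) := by
    have hk : 0 ≤ 2 * h * k := by positivity
    rw [show 2 * h * (k + 1 : ℕ) = 2 * h * k + 2 * h by push_cast; ring]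
    refine intervalIntegral_mul_nonneg_of_antiperiodic hh.le
      (hanti.mono fun ω hω ↦ hk.trans_lt hω.1) hanti_sin (fun ω hω ↦ ?_)
      fun _ _ ↦ hF.intervalIntegrable
    have hch : c * h = π := mul_inv_cancel_left₀ hc.ne' π
    have hshift : c * ω = c * (ω - 2 * h * k) + k * (2 * π) := by
      linear_combination 2 * (k : ℝ) * hch
    rw [hshift, sin_add_nat_mul_two_pi]
    refine sin_nonneg_of_nonneg_of_le_pi (mul_nonneg hc.le (by linarith [hω.1])) ?_
    exact hch ▸ mul_le_mul_of_nonneg_left (by linarith [hω.2]) hc.le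
  have hpartial (n : ℕ) : 0 ≤ ∫ ω in (0 : ℝ)..(2 * h * n), V ω * sin (c * ω) := by
    have hsum := intervalIntegral.sum_integral_adjacent_intervals (a := fun k : ℕ ↦ 2 * h * k)
      (n := n) fun k _ ↦ hF.intervalIntegrable
    rw [Nat.cast_zero, mul_zero] at hsum
    exact hsum ▸ Finset.sum_nonneg fun k _ ↦ hperiod k
  exact ge_of_tendsto' (intervalIntegral_tendsto_integral_Ioi 0 hF.integrableOn
    (tendsto_natCast_atTop_atTop.const_mul_atTop (by positivity))) hpartial

lemma sineTransform_nonneg (hV : Integrable V) (hodd : V.Odd) (hanti : AntitoneOn V (Ioi 0))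
    {z : ℝ} (hz : 0 ≤ z) : 0 ≤ sineTransform V z := by
  rcases hz.eq_or_lt with rfl | hz
  · rw [sineTransform_zero]
  · rw [sineTransform_eq_two_mul hodd]
    exact mul_nonneg zero_le_two (integral_Ioi_mul_sin_nonneg hV hanti (by positivity))

lemma integral_sin_eq_sinePrimitive (a ω : ℝ) :
    ∫ z in (0 : ℝ)..a, sin (2 * π * z * ω) = sinePrimitive a ω := by
  have hcomm : (fun z ↦ sin (2 * π * z * ω)) = fun z ↦ sin (2 * π * ω * z) := by
    ext z
    ring_nf
  rcases eq_or_ne ω 0 with rfl | hω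
  · simp [sinePrimitive]
  · rw [hcomm, intervalIntegral.integral_comp_mul_left (fun z ↦ sin z) (by positivity),
      integral_sin, sinePrimitive, mul_zero, cos_zero, smul_eq_mul, inv_mul_eq_div,
      mul_right_comm _ ω]

lemma continuous_sinePrimitive (a : ℝ) : Continuous (sinePrimitive a) := by
  simp only [← funext (integral_sin_eq_sinePrimitive a)]
  fun_prop

lemma abs_sinePrimitive_le (a ω : ℝ) : |sinePrimitive a ω| ≤ |a| := by
  rw [← integral_sin_eq_sinePrimitive]
  simpa using intervalIntegral.norm_integral_le_of_norm_le_const (a := 0) (b := a)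
    (f := fun z ↦ sin (2 * π * z * ω)) fun z _ ↦ abs_sin_le_one _

lemma sinePrimitive_nonneg (a : ℝ) {ω : ℝ} (hω : 0 ≤ ω) : 0 ≤ sinePrimitive a ω :=
  div_nonneg (sub_nonneg.2 (cos_le_one _)) (by positivity)

lemma sinePrimitive_le_inv (a : ℝ) {ω : ℝ} (hω : 0 < ω) : sinePrimitive a ω ≤ (π * ω)⁻¹ := by
  rw [sinePrimitive, div_le_iff₀ (by positivity)]
  have hcancel : (π * ω)⁻¹ * (2 * π * ω) = 2 := by field_simp
  linarith [neg_one_le_cos (2 * π * a * ω)]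

lemma sinePrimitive_le_mul (a : ℝ) {ω : ℝ} (hω : 0 < ω) :
    sinePrimitive a ω ≤ π * a ^ 2 * ω := by
  rw [sinePrimitive, div_le_iff₀ (by positivity)]
  linarith [one_sub_sq_div_two_le_cos (x := 2 * π * a * ω)]

lemma integral_Ioc_integral_Ioi_mul_sin (hV : IntegrableOn V (Ioi 0)) {a : ℝ} (ha : 0 ≤ a) :
    ∫ z in Ioc 0 a, ∫ ω in Ioi 0, V ω * sin (2 * π * z * ω) =
      ∫ ω in Ioi 0, V ω * sinePrimitive a ω := by
  have hprod : Integrable (fun p : ℝ × ℝ ↦ V p.2 * sin (2 * π * p.1 * p.2))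
      ((volume.restrict (Ioc 0 a)).prod (volume.restrict (Ioi 0))) := by
    refine Integrable.mul_bdd (c := 1) ?_ (by fun_prop) (.of_forall fun p ↦ abs_sin_le_one _)
    exact hV.comp_snd _
  rw [integral_integral_swap hprod]
  congr! 2 with ω
  rw [integral_const_mul, ← intervalIntegral.integral_of_le ha, integral_sin_eq_sinePrimitive]

lemma integral_abs_sineTransform (hV : Integrable V) (hodd : V.Odd) (hanti : AntitoneOn V (Ioi 0))
    {a : ℝ} (ha : 0 ≤ a) :
    ∫ z in (-a)..a, |sineTransform V z| = 4 * ∫ ω in Ioi 0, V ω * sinePrimitive a ω := by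
  have hint (b c : ℝ) : IntervalIntegrable (fun z ↦ |sineTransform V z|) volume b c :=
    (continuous_sineTransform hV).abs.intervalIntegrable b c
  have hreflect : ∫ z in (-a)..0, |sineTransform V z| = ∫ z in (0 : ℝ)..a, |sineTransform V z| := by
    have := intervalIntegral.integral_comp_neg (a := 0) (b := a) fun z ↦ |sineTransform V z|
    simpa only [sineTransform_neg, abs_neg, neg_zero] using this.symm
  have hright : ∫ z in (0 : ℝ)..a, |sineTransform V z| =
      2 * ∫ ω in Ioi 0, V ω * sinePrimitive a ω := by
    rw [← integral_Ioc_integral_Ioi_mul_sin hV.integrableOn ha, ← integral_const_mul,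
      intervalIntegral.integral_of_le ha]
    exact setIntegral_congr_fun measurableSet_Ioc fun z hz ↦
      (abs_of_nonneg (sineTransform_nonneg hV hodd hanti hz.1.le)).trans
        (sineTransform_eq_two_mul hodd z)
  rw [← intervalIntegral.integral_add_adjacent_intervals (hint _ 0) (hint _ _), hreflect, hright]
  ring

end SineTransform

/-! ### The spectral norm as a bilinear form -/

section BilinearForm

variable {V g p : ℝ → ℝ}

lemma im_conj_fourier_mul_fourier (hg : Integrable g) (hp : Integrable p) (ω : ℝ) :
    (starRingEnd ℂ (𝓕 (fun t ↦ (g t : ℂ)) ω) * 𝓕 (fun t ↦ (p t : ℂ)) ω).im =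
      ∫ q : ℝ × ℝ, p q.1 * g q.2 * sin (2 * π * ω * (q.2 - q.1)) := by
  calc (starRingEnd ℂ (𝓕 (fun t ↦ (g t : ℂ)) ω) * 𝓕 (fun t ↦ (p t : ℂ)) ω).im
      = (∫ y, p y * cos (2 * π * ω * y)) * (∫ x, g x * sin (2 * π * ω * x)) -
          (∫ y, p y * sin (2 * π * ω * y)) * ∫ x, g x * cos (2 * π * ω * x) := by
        rw [Complex.mul_im, Complex.conj_re, Complex.conj_im, fourier_ofReal_re hg,
          fourier_ofReal_im hg, fourier_ofReal_re hp, fourier_ofReal_im hp]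
        ring
    _ = ∫ q : ℝ × ℝ, p q.1 * g q.2 * sin (2 * π * ω * (q.2 - q.1)) := by
        rw [← integral_prod_mul, ← integral_prod_mul,
          ← integral_sub ((integrable_mul_cos hp _).mul_prod (integrable_mul_sin hg _))
            ((integrable_mul_sin hp _).mul_prod (integrable_mul_cos hg _))]
        refine integral_congr_ae (.of_forall fun q ↦ ?_)
        simp only [mul_sub, sin_sub]
        ring

lemma integrable_uncurry_mul_sin_sub (hV : Integrable V) (hg : Integrable g)
    (hp : Integrable p) :
    Integrable (uncurry fun (ω : ℝ) (q : ℝ × ℝ) ↦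
      V ω * (p q.1 * g q.2 * sin (2 * π * ω * (q.2 - q.1)))) := by
  have hbdd : Integrable fun r : ℝ × ℝ × ℝ ↦
      V r.1 * (p r.2.1 * g r.2.2) * sin (2 * π * r.1 * (r.2.2 - r.2.1)) :=
    (hV.mul_prod (hp.mul_prod hg)).mul_bdd (c := 1) (by fun_prop)
      (.of_forall fun r ↦ abs_sin_le_one _)
  exact hbdd.congr (.of_forall fun r ↦ by simp only [uncurry, mul_assoc])

lemma integrable_mul_im_conj_fourier_mul_fourier (hV : Integrable V) (hg : Integrable g)
    (hp : Integrable p) : Integrable fun ω ↦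
      V ω * (starRingEnd ℂ (𝓕 (fun t ↦ (g t : ℂ)) ω) * 𝓕 (fun t ↦ (p t : ℂ)) ω).im := by
  simp only [im_conj_fourier_mul_fourier hg hp, ← integral_const_mul]
  exact (integrable_uncurry_mul_sin_sub hV hg hp).integral_prod_left

lemma integral_mul_im_conj_fourier_mul_fourier (hV : Integrable V) (hg : Integrable g)
    (hp : Integrable p) :
    ∫ ω, V ω * (starRingEnd ℂ (𝓕 (fun t ↦ (g t : ℂ)) ω) * 𝓕 (fun t ↦ (p t : ℂ)) ω).im =
      ∫ y, p y * ∫ x, g x * sineTransform V (x - y) := by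
  have hint := integrable_uncurry_mul_sin_sub hV hg hp
  have hinner (y x : ℝ) : ∫ ω, V ω * (p y * g x * sin (2 * π * ω * (x - y))) =
      p y * (g x * sineTransform V (x - y)) := by
    rw [sineTransform, ← mul_assoc, ← integral_const_mul]
    refine integral_congr_ae (.of_forall fun ω ↦ ?_)
    simp only [mul_right_comm (2 * π) ω]
    ring
  simp only [im_conj_fourier_mul_fourier hg hp, ← integral_const_mul]
  rw [integral_integral_swap hint]
  refine (integral_prod _ hint.integral_prod_right).trans ?_
  simp only [uncurry_apply_pair, hinner]

lemma abs_integral_mul_integral_mul_sub_le {S : ℝ → ℝ} (hS : Continuous S) (hp : Integrable p)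
    {b c B : ℝ} (hB : ∀ᵐ x, |g x| ≤ B) (hg_supp : support g ⊆ Icc b c)
    (hp_supp : support p ⊆ Icc b c) :
    |∫ y, p y * ∫ x, g x * S (x - y)| ≤
      (∫ y, |p y|) * (B * ∫ z in (b - c)..(c - b), |S z|) := by
  obtain ⟨x₀, hx₀⟩ := hB.exists
  have hB_nonneg : 0 ≤ B := (abs_nonneg _).trans hx₀
  rw [← integral_mul_const, ← norm_eq_abs]
  refine norm_integral_le_of_norm_le (hp.abs.mul_const _) (.of_forall fun y ↦ ?_)
  by_cases hy : y ∈ Icc b c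
  swap
  · simp [notMem_support.1 fun h ↦ hy (hp_supp h)]
  rw [norm_mul, norm_eq_abs (p y)]
  refine mul_le_mul_of_nonneg_left ?_ (abs_nonneg _)
  have hbc : b ≤ c := hy.1.trans hy.2
  calc ‖∫ x, g x * S (x - y)‖ = ‖∫ x in Icc b c, g x * S (x - y)‖ := by
        rw [setIntegral_eq_integral_of_forall_compl_eq_zero fun x hx ↦ ?_]
        rw [notMem_support.1 fun h ↦ hx (hg_supp h), zero_mul]
    _ ≤ ∫ x in Icc b c, B * |S (x - y)| := by
        refine norm_integral_le_of_norm_le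
          (Continuous.integrableOn_Icc (by fun_prop)) (ae_restrict_of_ae ?_)
        filter_upwards [hB] with x hx
        exact (norm_mul _ _).trans_le (mul_le_mul_of_nonneg_right hx (abs_nonneg _))
    _ = B * ∫ z in (b - y)..(c - y), |S z| := by
        rw [integral_const_mul, integral_Icc_eq_integral_Ioc,
          ← intervalIntegral.integral_of_le hbc,
          intervalIntegral.integral_comp_sub_right (fun z ↦ |S z|)]
    _ ≤ B * ∫ z in (b - c)..(c - b), |S z| := by
        refine mul_le_mul_of_nonneg_left ?_ hB_nonneg
        exact intervalIntegral.integral_mono_interval (by linarith [hy.2]) (by linarith)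
          (by linarith [hy.1]) (.of_forall fun z ↦ abs_nonneg _) (hS.abs.intervalIntegrable _ _)

end BilinearForm

lemma fourier_deriv_ofReal {f : ℝ → ℝ} (hf : Integrable f) (hd : Differentiable ℝ f)
    (hf' : Integrable (deriv f)) (ω : ℝ) :
    𝓕 (fun t ↦ ((deriv f t : ℝ) : ℂ)) ω =
      2 * π * Complex.I * ω * 𝓕 (fun t ↦ (f t : ℂ)) ω := by
  have hderiv (t) : HasDerivAt (fun t ↦ (f t : ℂ)) (deriv f t : ℝ) t :=
    (hd t).hasDerivAt.ofReal_comp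
  have heq : (fun t ↦ ((deriv f t : ℝ) : ℂ)) = deriv fun t ↦ (f t : ℂ) :=
    funext fun t ↦ (hderiv t).deriv.symm
  rw [heq, Real.fourier_deriv hf.ofReal (fun t ↦ (hderiv t).differentiableAt)
    (heq ▸ hf'.ofReal)]
  rfl

lemma fourier_ofReal_sub {f g : ℝ → ℝ} (hf : Integrable f) (hg : Integrable g) (ω : ℝ) :
    𝓕 (fun t ↦ ((f t - g t : ℝ) : ℂ)) ω =
      𝓕 (fun t ↦ (f t : ℂ)) ω - 𝓕 (fun t ↦ (g t : ℂ)) ω := by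
  simp only [Real.fourier_real_eq_integral_exp_smul]
  rw [← integral_sub (integrable_exp_smul_ofReal hf ω) (integrable_exp_smul_ofReal hg ω)]
  simp only [Complex.ofReal_sub, smul_sub]

lemma integrable_deriv_deriv_of_ae_le {f : ℝ → ℝ} (hc : HasCompactSupport f) {C : ℝ}
    (hC : ∀ᵐ t, |deriv (deriv f) t| ≤ C) : Integrable (deriv (deriv f)) := by
  have hsupp : support (deriv (deriv f)) ⊆ tsupport f :=
    (subset_tsupport _).trans (tsupport_deriv_subset.trans tsupport_deriv_subset)
  rw [← integrableOn_iff_integrable_of_support_subset hsupp]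
  exact .of_bound hc.isCompact.measure_lt_top (measurable_deriv _).aestronglyMeasurable C
    (ae_restrict_of_ae hC)

/-- The odd weight for which `∫ |f̂|² / Q` is, up to the factor `2π`, the bilinear form
`∫ dualWeight Q · Im (conj ĝ · p̂)` of `g = f - f''` and `p = f'`. -/
noncomputable def dualWeight (Q : ℝ → ℝ) (ω : ℝ) : ℝ :=
  1 / (ω * (1 + 4 * π ^ 2 * ω ^ 2) * Q ω)

namespace TwiceDifferentiable

variable {f : ℝ → ℝ}

lemma integrable (hf : TwiceDifferentiable f) (hc : HasCompactSupport f) : Integrable f :=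
  hf.1.continuous.integrable_of_hasCompactSupport hc

lemma integrable_deriv (hf : TwiceDifferentiable f) (hc : HasCompactSupport f) :
    Integrable (deriv f) :=
  hf.2.continuous.integrable_of_hasCompactSupport hc.deriv

lemma fourier_sub_deriv_deriv (hf : TwiceDifferentiable f) (hc : HasCompactSupport f)
    (h2 : Integrable (deriv (deriv f))) (ω : ℝ) :
    𝓕 (fun t ↦ ((f t - deriv (deriv f) t : ℝ) : ℂ)) ω =
      (1 + 4 * π ^ 2 * ω ^ 2 : ℝ) * 𝓕 (fun t ↦ (f t : ℂ)) ω := by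
  rw [fourier_ofReal_sub (hf.integrable hc) h2,
    fourier_deriv_ofReal (hf.integrable_deriv hc) hf.2 h2,
    fourier_deriv_ofReal (hf.integrable hc) hf.1 (hf.integrable_deriv hc)]
  push_cast
  linear_combination -4 * (π : ℂ) ^ 2 * ω ^ 2 * 𝓕 (fun t ↦ (f t : ℂ)) ω * Complex.I_sq

lemma im_conj_fourier_mul_fourier (hf : TwiceDifferentiable f) (hc : HasCompactSupport f)
    (h2 : Integrable (deriv (deriv f))) (ω : ℝ) :
    (starRingEnd ℂ (𝓕 (fun t ↦ ((f t - deriv (deriv f) t : ℝ) : ℂ)) ω) *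
        𝓕 (fun t ↦ ((deriv f t : ℝ) : ℂ)) ω).im =
      2 * π * ω * (1 + 4 * π ^ 2 * ω ^ 2) * ‖𝓕 (fun t ↦ (f t : ℂ)) ω‖ ^ 2 := by
  rw [hf.fourier_sub_deriv_deriv hc h2,
    fourier_deriv_ofReal (hf.integrable hc) hf.1 (hf.integrable_deriv hc), Complex.sq_norm,
    Complex.normSq_apply]
  simp only [map_mul, Complex.conj_ofReal, Complex.mul_re, Complex.mul_im, Complex.conj_re,
    Complex.conj_im, Complex.ofReal_re, Complex.ofReal_im, Complex.I_re, Complex.I_im,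
    Complex.re_ofNat, Complex.im_ofNat]
  ring

lemma spectralNormSq_eq (hf : TwiceDifferentiable f) (hc : HasCompactSupport f)
    (h2 : Integrable (deriv (deriv f))) {Q : ℝ → ℝ} (hQ : IsSpectralDensity Q)
    (hV : Integrable (dualWeight Q)) :
    spectralNormSq Q f = ENNReal.ofReal ((2 * π)⁻¹ * ∫ y, deriv f y *
      ∫ x, (f x - deriv (deriv f) x) * sineTransform (dualWeight Q) (x - y)) := by
  have hg : Integrable fun x ↦ f x - deriv (deriv f) x := (hf.integrable hc).sub h2
  have hp := hf.integrable_deriv hc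
  have hpt : ∀ᵐ ω, (2 * π)⁻¹ * (dualWeight Q ω *
      (starRingEnd ℂ (𝓕 (fun t ↦ ((f t - deriv (deriv f) t : ℝ) : ℂ)) ω) *
        𝓕 (fun t ↦ ((deriv f t : ℝ) : ℂ)) ω).im) = ‖𝓕 (fun t ↦ (f t : ℂ)) ω‖ ^ 2 / Q ω := by
    filter_upwards [Measure.ae_ne volume (0 : ℝ)] with ω hω
    have hQω := (hQ.pos ω hω).ne'
    have : 1 + 4 * π ^ 2 * ω ^ 2 ≠ 0 := by positivity
    rw [hf.im_conj_fourier_mul_fourier hc h2, dualWeight]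
    field_simp
  rw [← integral_mul_im_conj_fourier_mul_fourier hV hg hp, ← integral_const_mul,
    integral_congr_ae hpt, ofReal_integral_eq_lintegral_ofReal, spectralNormSq]
  · exact ((integrable_mul_im_conj_fourier_mul_fourier hV hg hp).const_mul _).congr hpt
  · exact .of_forall fun ω ↦ div_nonneg (sq_nonneg _) (hQ.nonneg ω)

lemma spectralNormSq_le (hf : TwiceDifferentiable f) {b c : ℝ} (hs : support f ⊆ Icc b c)
    (h2 : Integrable (deriv (deriv f))) {Q : ℝ → ℝ} (hQ : IsSpectralDensity Q)
    (hV : Integrable (dualWeight Q)) {B : ℝ} (hB : ∀ᵐ x, |f x - deriv (deriv f) x| ≤ B) :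
    spectralNormSq Q f ≤ ENNReal.ofReal ((2 * π)⁻¹ * ((∫ y, |deriv f y|) *
      (B * ∫ z in (b - c)..(c - b), |sineTransform (dualWeight Q) z|))) := by
  have hc : HasCompactSupport f := .of_support_subset_isCompact isCompact_Icc hs
  have ht : tsupport f ⊆ Icc b c := closure_minimal hs isClosed_Icc
  have hs' : support (deriv f) ⊆ Icc b c := support_deriv_subset.trans ht
  have hs'' : support (deriv (deriv f)) ⊆ Icc b c :=
    support_deriv_subset.trans (closure_minimal hs' isClosed_Icc)
  rw [hf.spectralNormSq_eq hc h2 hQ hV]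
  refine ENNReal.ofReal_le_ofReal (mul_le_mul_of_nonneg_left ((le_abs_self _).trans ?_)
    (by positivity))
  exact abs_integral_mul_integral_mul_sub_le (continuous_sineTransform hV)
    (hf.integrable_deriv hc) hB ((support_sub f _).trans (union_subset hs hs'')) hs'

lemma spectralNormSq_ne_top (hf : TwiceDifferentiable f) (hc : HasCompactSupport f)
    (h2 : Integrable (deriv (deriv f))) {Q : ℝ → ℝ} (hQ : IsSpectralDensity Q)
    (hV : Integrable (dualWeight Q)) : spectralNormSq Q f ≠ ∞ := by
  rw [hf.spectralNormSq_eq hc h2 hQ hV]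
  exact ENNReal.ofReal_ne_top

lemma spectralNormSq_le_of_eLpNorm_ne_top (hf : TwiceDifferentiable f) {b c : ℝ}
    (hs : support f ⊆ Icc b c) {Q : ℝ → ℝ} (hQ : IsSpectralDensity Q)
    (hV : Integrable (dualWeight Q)) {M : ℝ}
    (hM : (2 * π)⁻¹ * ∫ z in (b - c)..(c - b), |sineTransform (dualWeight Q) z| ≤ M)
    (hfin : eLpNorm (fun t ↦ f t - deriv (deriv f) t) ∞ volume ≠ ∞) :
    spectralNormSq Q f ≤ eLpNorm (deriv f) 1 volume *
      eLpNorm (fun t ↦ f t - deriv (deriv f) t) ∞ volume * ENNReal.ofReal M := by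
  have hc : HasCompactSupport f := .of_support_subset_isCompact isCompact_Icc hs
  set B := (eLpNorm (fun t ↦ f t - deriv (deriv f) t) ∞ volume).toReal with hB_def
  have hB : ∀ᵐ x, |f x - deriv (deriv f) x| ≤ B := by
    filter_upwards [ae_le_eLpNormEssSup (f := fun t ↦ f t - deriv (deriv f) t)
      (μ := volume)] with x hx
    rw [← eLpNorm_exponent_top] at hx
    exact (toReal_enorm _).symm.trans_le (ENNReal.toReal_mono hfin hx)
  obtain ⟨C, hC⟩ := hf.1.continuous.bounded_above_of_compact_support hc
  have h2 : Integrable (deriv (deriv f)) := by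
    refine integrable_deriv_deriv_of_ae_le (C := B + C) hc ?_
    filter_upwards [hB] with x hx
    calc |deriv (deriv f) x| ≤ |f x - deriv (deriv f) x| + |f x| := by
          simpa [abs_sub_comm, add_comm] using abs_sub_le (deriv (deriv f) x) (f x) 0
      _ ≤ B + C := add_le_add hx (hC x)
  have hL1 : eLpNorm (deriv f) 1 volume = ENNReal.ofReal (∫ y, |deriv f y|) := by
    rw [eLpNorm_one_eq_lintegral_enorm,
      ← ofReal_integral_norm_eq_lintegral_enorm (hf.integrable_deriv hc)]
    rfl
  have hL1_nonneg : 0 ≤ ∫ y, |deriv f y| := integral_nonneg fun y ↦ abs_nonneg _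
  have hB_nonneg : 0 ≤ B := ENNReal.toReal_nonneg
  rw [hL1, ← ENNReal.ofReal_toReal hfin, ← hB_def, ← ENNReal.ofReal_mul hL1_nonneg,
    ← ENNReal.ofReal_mul (by positivity)]
  refine (hf.spectralNormSq_le hs h2 hQ hV hB).trans (ENNReal.ofReal_le_ofReal ?_)
  linarith [mul_le_mul_of_nonneg_left hM (mul_nonneg hL1_nonneg hB_nonneg)]

lemma spectralNormSq_le_eLpNorm (hf : TwiceDifferentiable f) {b c : ℝ}
    (hs : support f ⊆ Icc b c) {Q : ℝ → ℝ} (hQ : IsSpectralDensity Q)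
    (hV : Integrable (dualWeight Q)) {M : ℝ} (hM_pos : 0 < M)
    (hM : (2 * π)⁻¹ * ∫ z in (b - c)..(c - b), |sineTransform (dualWeight Q) z| ≤ M) :
    spectralNormSq Q f ≤ eLpNorm (deriv f) 1 volume *
      eLpNorm (fun t ↦ f t - deriv (deriv f) t) ∞ volume * ENNReal.ofReal M := by
  by_cases hfin : eLpNorm (fun t ↦ f t - deriv (deriv f) t) ∞ volume = ∞
  swap
  · exact hf.spectralNormSq_le_of_eLpNorm_ne_top hs hQ hV hM hfin
  by_cases hzero : eLpNorm (deriv f) 1 volume = 0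
  · rw [eLpNorm_eq_zero_iff hf.2.continuous.aestronglyMeasurable one_ne_zero,
      hf.2.continuous.ae_eq_iff_eq volume continuous_zero] at hzero
    have hf_zero : f = 0 := by
      ext x
      rw [is_const_of_deriv_eq_zero hf.1 (congrFun hzero) x (c + 1)]
      exact notMem_support.1 fun h ↦ (lt_add_one c).not_ge (hs h).2
    simp [hf_zero, spectralNormSq, Real.fourier_real_eq_integral_exp_smul]
  · rw [hfin, ENNReal.mul_top hzero, ENNReal.top_mul (ENNReal.ofReal_pos.2 hM_pos).ne']
    exact le_top

end TwiceDifferentiable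

lemma spectralNormSq_ne_top_of_contDiff {f : ℝ → ℝ} (hf : ContDiff ℝ 2 f)
    (hc : HasCompactSupport f) {Q : ℝ → ℝ} (hQ : IsSpectralDensity Q)
    (hV : Integrable (dualWeight Q)) : spectralNormSq Q f ≠ ∞ := by
  have hf' : ContDiff ℝ 1 (deriv f) := (contDiff_succ_iff_deriv (n := 1).1 hf).2.2
  have h2 : Integrable (deriv (deriv f)) :=
    (hf'.continuous_deriv le_rfl).integrable_of_hasCompactSupport hc.deriv.deriv
  have htd : TwiceDifferentiable f :=
    ⟨hf.differentiable two_ne_zero, hf'.differentiable one_ne_zero⟩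
  exact htd.spectralNormSq_ne_top hc h2 hQ hV

/-! ### The factors of the explicit density -/

lemma one_div_twelve_le_log {x : ℝ} (hx : 12 / 11 ≤ x) : 1 / 12 ≤ log x := by
  have hlog := one_sub_inv_le_log_of_pos (show 0 < x by linarith)
  have hinv : x⁻¹ ≤ (12 / 11)⁻¹ := inv_anti₀ (by norm_num) hx
  norm_num at hinv
  linarith

lemma twelve_div_eleven_le_log {x : ℝ} (hx : 3 ≤ x) : 12 / 11 ≤ log x :=
  calc (12 / 11 : ℝ) ≤ 1.0986122885 := by norm_num
    _ ≤ log 3 := log_three_gt_d9.le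
    _ ≤ log x := log_le_log (by norm_num) hx

lemma log_pi_pos : 0 < log π := log_pos (by linarith [pi_gt_three])

lemma one_div_twelve_le_log_log_pi : 1 / 12 ≤ log (log π) :=
  one_div_twelve_le_log (twelve_div_eleven_le_log pi_gt_three.le)

lemma log_sq_le_four_mul {x : ℝ} (hx : 1 ≤ x) : log x ^ 2 ≤ 4 * x := by
  have hlog := log_le_sub_one_of_pos (sqrt_pos.2 (one_pos.trans_le hx))
  rw [log_sqrt (zero_le_one.trans hx)] at hlog
  calc log x ^ 2 ≤ (2 * √x) ^ 2 := pow_le_pow_left₀ (log_nonneg hx) (by linarith) 2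
    _ = 4 * x := by rw [mul_pow, sq_sqrt (zero_le_one.trans hx)]; norm_num

/-- Concavity: `v` is at least the convex combination of `u` and `c` with weight `l⁻¹` at `u`. -/
lemma log_add_sub_one_mul_log_le {u v c l : ℝ} (hu : 0 < u) (hc : 0 < c) (hl : 1 ≤ l)
    (h : u + (l - 1) * c ≤ l * v) : log u + (l - 1) * log c ≤ l * log v := by
  have hl_pos : 0 < l := one_pos.trans_le hl
  have hcomb : l⁻¹ * u + (1 - l⁻¹) * c ≤ v := by
    rw [← mul_le_mul_iff_right₀ hl_pos]
    refine le_of_eq_of_le ?_ h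
    field_simp
  have hw : 0 ≤ 1 - l⁻¹ := sub_nonneg.2 (inv_le_one_of_one_le₀ hl)
  have hconcave := strictConcaveOn_log_Ioi.concaveOn.2 (mem_Ioi.2 hu) (mem_Ioi.2 hc)
    (inv_nonneg.2 hl_pos.le) hw (add_sub_cancel _ _)
  simp only [smul_eq_mul] at hconcave
  have hmono := hconcave.trans (log_le_log (by positivity) hcomb)
  calc log u + (l - 1) * log c = l * (l⁻¹ * log u + (1 - l⁻¹) * log c) := by field_simp
    _ ≤ l * log v := mul_le_mul_of_nonneg_left hmono hl_pos.le

lemma rpow_neg_half_eq_inv_sqrt {x : ℝ} (hx : 0 ≤ x) : x ^ (-1 / 2 : ℝ) = (√x)⁻¹ := by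
  rw [sqrt_eq_rpow, ← rpow_neg hx, neg_div]

lemma rpow_neg_three_halves_eq_inv_sqrt_pow {x : ℝ} (hx : 0 ≤ x) :
    x ^ (-3 / 2 : ℝ) = (√x ^ 3)⁻¹ := by
  rw [← inv_pow, ← rpow_neg_half_eq_inv_sqrt hx, ← rpow_natCast, ← rpow_mul hx]
  norm_num

lemma one_le_four_mul_pi_sq : 1 ≤ 4 * π ^ 2 := by nlinarith [pi_gt_three]

/-- The factor `log (π + |x|^{-1/2})` of the density. -/
noncomputable def logFactor (x : ℝ) : ℝ := log (π + |x| ^ (-1 / 2 : ℝ))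

/-- The factor `log (π + |x|^{-1/2}) · (log log (π + |x|^{-1/2}))²` of the density. -/
noncomputable def logWeight (x : ℝ) : ℝ := logFactor x * log (logFactor x) ^ 2

/-- The factor `(1 + |x|²/4π²)^{1/4}` of the density. -/
noncomputable def quarticFactor (x : ℝ) : ℝ := (1 + |x| ^ 2 / (4 * π ^ 2)) ^ (1 / 4 : ℝ)

/-- The constant numerator of the density. -/
noncomputable def densityConst : ℝ := 1 / 4 * log (log π)

lemma logFactor_of_pos {x : ℝ} (hx : 0 < x) : logFactor x = log (π + x ^ (-1 / 2 : ℝ)) := by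
  rw [logFactor, abs_of_pos hx]

lemma log_pi_le_logFactor (x : ℝ) : log π ≤ logFactor x :=
  log_le_log pi_pos (le_add_of_nonneg_right (rpow_nonneg (abs_nonneg x) _))

lemma one_le_logFactor (x : ℝ) : 1 ≤ logFactor x := by
  linarith [twelve_div_eleven_le_log pi_gt_three.le, log_pi_le_logFactor x]

lemma logFactor_pos (x : ℝ) : 0 < logFactor x := one_pos.trans_le (one_le_logFactor x)

lemma log_logFactor_pos (x : ℝ) : 0 < log (logFactor x) := by
  linarith [one_div_twelve_le_log_log_pi, log_le_log log_pi_pos (log_pi_le_logFactor x)]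

lemma logWeight_pos (x : ℝ) : 0 < logWeight x :=
  mul_pos (logFactor_pos x) (pow_pos (log_logFactor_pos x) 2)

lemma antitoneOn_logFactor : AntitoneOn logFactor (Ioi 0) := by
  intro x hx y hy hxy
  rw [logFactor_of_pos hx, logFactor_of_pos hy]
  exact log_le_log (by have := mem_Ioi.1 hy; positivity)
    (by gcongr 1; exact rpow_le_rpow_of_nonpos hx hxy (by norm_num))

lemma logWeight_le_mul_of_logFactor_le {x l v : ℝ} (h : logFactor x ≤ l * v)
    (hlog : log (logFactor x) ≤ l * log v) : logWeight x ≤ l ^ 3 * (v * log v ^ 2) :=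
  calc logWeight x ≤ (l * v) * (l * log v) ^ 2 := by
        have := logFactor_pos x
        have := log_logFactor_pos x
        rw [logWeight]
        gcongr
        exact (logFactor_pos x).le.trans h
    _ = l ^ 3 * (v * log v ^ 2) := by ring

lemma antitoneOn_logWeight : AntitoneOn logWeight (Ioi 0) := by
  intro x hx y hy hxy
  have hfactor := antitoneOn_logFactor hx hy hxy
  have hlog := log_le_log (logFactor_pos y) hfactor
  have := log_logFactor_pos y
  have := logFactor_pos x
  unfold logWeight
  gcongr

lemma logWeight_le {x : ℝ} (hx : 0 < x) : logWeight x ≤ 16 * (π + x ^ (-1 / 2 : ℝ)) := by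
  have hsum : 1 ≤ π + x ^ (-1 / 2 : ℝ) := by linarith [pi_gt_three, rpow_nonneg hx.le (-1 / 2)]
  calc logWeight x ≤ logFactor x * (4 * logFactor x) :=
        mul_le_mul_of_nonneg_left (log_sq_le_four_mul (one_le_logFactor x)) (logFactor_pos x).le
    _ = 4 * log (π + x ^ (-1 / 2 : ℝ)) ^ 2 := by rw [logFactor_of_pos hx]; ring
    _ ≤ 16 * (π + x ^ (-1 / 2 : ℝ)) := by linarith [log_sq_le_four_mul hsum]

lemma logWeight_le_rpow_mul {x z : ℝ} (hx : 0 < x) (hxz : x ≤ z) :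
    logWeight x ≤ (x / z) ^ (-3 / 2 : ℝ) * logWeight z := by
  have hz : 0 < z := hx.trans_le hxz
  set l := (x / z) ^ (-1 / 2 : ℝ) with l_def
  have hl : 1 ≤ l := one_le_rpow_of_pos_of_le_one_of_nonpos (by positivity)
    ((div_le_one hz).2 hxz) (by norm_num)
  have hl_cube : (x / z) ^ (-3 / 2 : ℝ) = l ^ 3 := by
    rw [l_def, ← rpow_natCast, ← rpow_mul (by positivity)]
    norm_num
  have hx_rpow : x ^ (-1 / 2 : ℝ) = l * z ^ (-1 / 2 : ℝ) := by
    rw [l_def, ← mul_rpow (by positivity) hz.le, div_mul_cancel₀ _ hz.ne']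
  have hlog : logFactor x + (l - 1) * log π ≤ l * logFactor z := by
    rw [logFactor_of_pos hx, logFactor_of_pos hz]
    refine log_add_sub_one_mul_log_le (by positivity) pi_pos hl (le_of_eq ?_)
    rw [hx_rpow]
    ring
  have hloglog := log_add_sub_one_mul_log_le (logFactor_pos x) log_pi_pos hl hlog
  have hlog_nonneg := mul_nonneg (sub_nonneg.2 hl) log_pi_pos.le
  have hloglog_nonneg : 0 ≤ (l - 1) * log (log π) :=
    mul_nonneg (sub_nonneg.2 hl) (by linarith [one_div_twelve_le_log_log_pi])
  rw [hl_cube]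
  exact logWeight_le_mul_of_logFactor_le (by linarith) (by linarith)

lemma logFactor_inv_le {a : ℝ} (ha : 3 ≤ a) : logFactor a⁻¹ ≤ 2 * log a := by
  have ha_pos : 0 < a := by linarith
  have hsqrt : (a⁻¹) ^ (-1 / 2 : ℝ) ≤ a := by
    rw [rpow_neg_half_eq_inv_sqrt (by positivity), sqrt_inv, inv_inv]
    exact sqrt_le_iff.2 ⟨by linarith, by nlinarith⟩
  rw [logFactor_of_pos (inv_pos.2 ha_pos), ← log_rpow ha_pos, rpow_two]
  refine log_le_log (by positivity) ?_
  nlinarith [pi_lt_four]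

lemma logWeight_inv_le {a : ℝ} (ha : 3 ≤ a) :
    logWeight a⁻¹ ≤ 2 * log a * (10 * log (log a)) ^ 2 := by
  have hlog := twelve_div_eleven_le_log ha
  have hloglog := one_div_twelve_le_log hlog
  have hfactor := logFactor_inv_le ha
  have hfactor_log : log (logFactor a⁻¹) ≤ 10 * log (log a) := by
    have := log_le_log (logFactor_pos a⁻¹) hfactor
    rw [log_mul two_ne_zero (by linarith)] at this
    linarith [log_two_lt_d9]
  have := log_logFactor_pos a⁻¹
  unfold logWeight
  gcongr

lemma quarticFactor_pos (x : ℝ) : 0 < quarticFactor x := by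
  unfold quarticFactor
  positivity

lemma quarticFactor_pow_four (x : ℝ) : quarticFactor x ^ 4 = 1 + x ^ 2 / (4 * π ^ 2) := by
  rw [quarticFactor, ← rpow_natCast, ← rpow_mul (by positivity), sq_abs]
  norm_num

lemma one_le_quarticFactor (x : ℝ) : 1 ≤ quarticFactor x :=
  one_le_rpow (le_add_of_nonneg_right (by positivity)) (by norm_num)

lemma monotoneOn_quarticFactor : MonotoneOn quarticFactor (Ici 0) := by
  intro x hx y _ hxy
  have := mem_Ici.1 hx
  unfold quarticFactor
  gcongr

lemma sqrt_le_quarticFactor {x : ℝ} (hx : 0 ≤ x) : √x ≤ 2 * π * quarticFactor x := by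
  have := quarticFactor_pos x
  refine le_of_pow_le_pow_left₀ four_ne_zero (by positivity) ?_
  calc √x ^ 4 = x ^ 2 := by rw [pow_mul √x 2 2, sq_sqrt hx]
    _ ≤ 4 * π ^ 2 * x ^ 2 := le_mul_of_one_le_left (sq_nonneg x) one_le_four_mul_pi_sq
    _ ≤ (2 * π) ^ 4 + 4 * π ^ 2 * x ^ 2 := le_add_of_nonneg_left (by positivity)
    _ = (2 * π * quarticFactor x) ^ 4 := by
      rw [mul_pow _ (quarticFactor x), quarticFactor_pow_four]
      field_simp
      ring

lemma quarticFactor_le_two_mul {x : ℝ} (hx : 1 ≤ x) : quarticFactor x ≤ 2 * x := by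
  refine le_of_pow_le_pow_left₀ four_ne_zero (by positivity) ?_
  calc quarticFactor x ^ 4 = 1 + x ^ 2 / (4 * π ^ 2) := quarticFactor_pow_four x
    _ ≤ x ^ 4 + x ^ 4 := add_le_add (one_le_pow₀ hx)
      ((div_le_self (sq_nonneg x) one_le_four_mul_pi_sq).trans
        (pow_le_pow_right₀ hx (by norm_num)))
    _ ≤ (2 * x) ^ 4 := by linarith [pow_nonneg (zero_le_one.trans hx) 4, mul_pow 2 x 4]

lemma one_div_forty_eight_le_densityConst : 1 / 48 ≤ densityConst := by
  unfold densityConst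
  linarith [one_div_twelve_le_log_log_pi]

lemma densityConst_pos : 0 < densityConst := by
  linarith [one_div_forty_eight_le_densityConst]

lemma integrable_of_integrableOn_Ioi {E : Type*} [NormedAddCommGroup E] [NormedSpace ℝ E]
    {f : ℝ → E} {c : ℝ} (hf : IntegrableOn f (Ioi 0)) (h : ∀ x, f (-x) = c • f x) :
    Integrable f := by
  have hind := (integrable_indicator_iff measurableSet_Ioi).2 hf
  refine (hind.add (hind.comp_neg.smul c)).congr ?_
  filter_upwards [Measure.ae_ne volume (0 : ℝ)] with x hx
  rcases lt_or_gt_of_ne hx with hneg | hpos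
  · simp [hneg, hneg.not_gt, ← h]
  · simp [hpos, hpos.not_gt]

/-! ### The dual weight and the density ratio -/

section DensityRatio

variable {Q : ℝ → ℝ}

lemma densityRatio_odd (hQ : Q.Even) (m : ℕ) : (densityRatio Q m).Odd := fun x ↦ by
  rw [densityRatio, densityRatio, hQ x, neg_div _ x, Even.neg_pow (even_two_mul m), neg_mul,
    neg_mul, div_neg]

lemma measurable_densityRatio (hQ : Measurable Q) (m : ℕ) : Measurable (densityRatio Q m) := by
  unfold densityRatio
  fun_prop

lemma densityRatio_nonneg (hQ : ∀ ω, 0 ≤ Q ω) (m : ℕ) {x : ℝ} (hx : 0 ≤ x) :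
    0 ≤ densityRatio Q m x := by
  have := hQ x
  unfold densityRatio
  positivity

/-- The ratio of the Lorentzians with half-widths `1 / 2π` and `2π`, by which `dualWeight Q` and
`densityRatio Q 1` differ. -/
noncomputable def lorentzianRatio (x : ℝ) : ℝ :=
  (1 + x ^ 2 / (4 * π ^ 2)) / (1 + 4 * π ^ 2 * x ^ 2)

lemma lorentzianRatio_nonneg (x : ℝ) : 0 ≤ lorentzianRatio x := by
  unfold lorentzianRatio
  positivity

lemma lorentzianRatio_le_one (x : ℝ) : lorentzianRatio x ≤ 1 := by
  have hscale : x ^ 2 / (4 * π ^ 2) ≤ 4 * π ^ 2 * x ^ 2 :=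
    (div_le_self (sq_nonneg x) one_le_four_mul_pi_sq).trans
      (le_mul_of_one_le_left (sq_nonneg x) one_le_four_mul_pi_sq)
  rw [lorentzianRatio, div_le_one (by positivity)]
  linarith

lemma antitoneOn_lorentzianRatio : AntitoneOn lorentzianRatio (Ici 0) := by
  intro x hx y _ hxy
  have hsq : x ^ 2 ≤ y ^ 2 := pow_le_pow_left₀ hx hxy 2
  have hscale : (4 * π ^ 2)⁻¹ ≤ 4 * π ^ 2 :=
    (inv_le_one_of_one_le₀ one_le_four_mul_pi_sq).trans one_le_four_mul_pi_sq
  simp only [lorentzianRatio, div_eq_mul_inv (_ ^ 2)]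
  rw [div_le_div_iff₀ (by positivity) (by positivity)]
  nlinarith [mul_nonneg (sub_nonneg.2 hsq) (sub_nonneg.2 hscale)]

lemma dualWeight_eq_mul_densityRatio (Q : ℝ → ℝ) (x : ℝ) :
    dualWeight Q x = (2 * π)⁻¹ * densityRatio Q 1 x * lorentzianRatio x := by
  have : 1 + x ^ 2 / (4 * π ^ 2) ≠ 0 := by positivity
  have hsq : (x / (2 * π)) ^ 2 = x ^ 2 / (4 * π ^ 2) := by ring
  rw [dualWeight, densityRatio, lorentzianRatio, mul_one, hsq]
  field_simp

lemma dualWeight_odd (hQ : Q.Even) : (dualWeight Q).Odd := fun x ↦ by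
  rw [dualWeight, dualWeight, hQ x, neg_sq, neg_mul, neg_mul, div_neg]

lemma antitoneOn_dualWeight (hQ : ∀ ω, 0 ≤ Q ω) (hR : AntitoneOn (densityRatio Q 1) (Ioi 0)) :
    AntitoneOn (dualWeight Q) (Ioi 0) := by
  intro x hx y hy hxy
  have := densityRatio_nonneg hQ 1 (mem_Ioi.1 hx).le
  simp only [dualWeight_eq_mul_densityRatio]
  exact mul_le_mul (mul_le_mul_of_nonneg_left (hR hx hy hxy) (by positivity))
    (antitoneOn_lorentzianRatio (mem_Ioi.1 hx).le (mem_Ioi.1 hy).le hxy) (lorentzianRatio_nonneg y)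
    (by positivity)

lemma integrable_dualWeight (hR : Integrable (densityRatio Q 1)) : Integrable (dualWeight Q) := by
  simp only [funext (dualWeight_eq_mul_densityRatio Q)]
  refine (hR.const_mul _).mul_bdd (c := 1) ?_ (.of_forall fun x ↦ ?_)
  · unfold lorentzianRatio
    exact Measurable.aestronglyMeasurable (by fun_prop)
  · rw [norm_of_nonneg (lorentzianRatio_nonneg x)]
    exact lorentzianRatio_le_one x

end DensityRatio

/-! ### The explicit density -/

lemma horizonFreeDensity_eq (x : ℝ) :
    horizonFreeDensity x = densityConst / (|x| * quarticFactor x * logWeight x) := by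
  rw [logWeight, ← mul_assoc]
  rfl

lemma horizonFreeDensity_pos {x : ℝ} (hx : x ≠ 0) : 0 < horizonFreeDensity x := by
  have := quarticFactor_pos x
  have := logWeight_pos x
  have := densityConst_pos
  rw [horizonFreeDensity_eq]
  positivity

lemma horizonFreeDensity_nonneg (x : ℝ) : 0 ≤ horizonFreeDensity x := by
  rcases eq_or_ne x 0 with rfl | hx
  · simp [horizonFreeDensity]
  · exact (horizonFreeDensity_pos hx).le

lemma horizonFreeDensity_even : horizonFreeDensity.Even := fun x ↦ by
  simp only [horizonFreeDensity, abs_neg]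

lemma measurable_horizonFreeDensity : Measurable horizonFreeDensity := by
  unfold horizonFreeDensity
  fun_prop

lemma densityRatio_horizonFreeDensity {x : ℝ} (hx : 0 < x) :
    densityRatio horizonFreeDensity 1 x =
      2 * π / densityConst * (logWeight x / quarticFactor x ^ 3) := by
  have := quarticFactor_pos x
  have := logWeight_pos x
  have := densityConst_pos
  have hquartic : 1 + (x / (2 * π)) ^ (2 * 1) = quarticFactor x ^ 4 := by
    rw [quarticFactor_pow_four]
    ring
  rw [densityRatio, hquartic, horizonFreeDensity_eq, abs_of_pos hx]
  field_simp

lemma antitoneOn_densityRatio_horizonFreeDensity :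
    AntitoneOn (densityRatio horizonFreeDensity 1) (Ioi 0) := by
  intro x hx y hy hxy
  have := logWeight_pos x
  have := quarticFactor_pos x
  have := densityConst_pos
  have := antitoneOn_logWeight hx hy hxy
  have := monotoneOn_quarticFactor (mem_Ioi.1 hx).le (mem_Ioi.1 hy).le hxy
  rw [densityRatio_horizonFreeDensity hx, densityRatio_horizonFreeDensity hy]
  gcongr

lemma densityRatio_horizonFreeDensity_le {x : ℝ} (hx : 0 < x) :
    densityRatio horizonFreeDensity 1 x ≤
      32 * π / densityConst * ((π + x ^ (-1 / 2 : ℝ)) / quarticFactor x ^ 3) := by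
  have := quarticFactor_pos x
  have := densityConst_pos
  calc densityRatio horizonFreeDensity 1 x
      = 2 * π / densityConst * (logWeight x / quarticFactor x ^ 3) :=
        densityRatio_horizonFreeDensity hx
    _ ≤ 2 * π / densityConst * (16 * (π + x ^ (-1 / 2 : ℝ)) / quarticFactor x ^ 3) := by
        gcongr
        exact logWeight_le hx
    _ = 32 * π / densityConst * ((π + x ^ (-1 / 2 : ℝ)) / quarticFactor x ^ 3) := by ring

lemma add_rpow_div_quarticFactor_le {x : ℝ} (hx : 1 ≤ x) :
    (π + x ^ (-1 / 2 : ℝ)) / quarticFactor x ^ 3 ≤ (π + 1) * (2 * π) ^ 3 * x ^ (-3 / 2 : ℝ) := by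
  have hx_pos : 0 < x := one_pos.trans_le hx
  have hquartic := quarticFactor_pos x
  have := sqrt_pos.2 hx_pos
  rw [rpow_neg_three_halves_eq_inv_sqrt_pow hx_pos.le, ← div_eq_mul_inv,
    div_le_div_iff₀ (by positivity) (by positivity)]
  calc (π + x ^ (-1 / 2 : ℝ)) * √x ^ 3 ≤ (π + 1) * (2 * π * quarticFactor x) ^ 3 := by
        gcongr
        · exact rpow_le_one_of_one_le_of_nonpos hx (by norm_num)
        · exact sqrt_le_quarticFactor hx_pos.le
    _ = (π + 1) * (2 * π) ^ 3 * quarticFactor x ^ 3 := by ring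

lemma integrableOn_densityRatio_horizonFreeDensity_Ioc :
    IntegrableOn (densityRatio horizonFreeDensity 1) (Ioc 0 1) := by
  have := densityConst_pos
  have hrpow : IntegrableOn (fun x : ℝ ↦ x ^ (-1 / 2 : ℝ)) (Ioc 0 1) :=
    (intervalIntegrable_iff_integrableOn_Ioc_of_le zero_le_one).1
      (intervalIntegral.intervalIntegrable_rpow' (by norm_num))
  refine (((integrable_const π).add hrpow).const_mul (32 * π / densityConst)).mono'
    (measurable_densityRatio measurable_horizonFreeDensity 1).aestronglyMeasurable ?_
  filter_upwards [ae_restrict_mem measurableSet_Ioc] with x hx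
  rw [norm_of_nonneg (densityRatio_nonneg horizonFreeDensity_nonneg 1 hx.1.le)]
  refine (densityRatio_horizonFreeDensity_le hx.1).trans ?_
  have hrpow_nonneg := rpow_nonneg hx.1.le (-1 / 2)
  exact mul_le_mul_of_nonneg_left
    (div_le_self (by positivity) (one_le_pow₀ (one_le_quarticFactor x))) (by positivity)

lemma integrableOn_densityRatio_horizonFreeDensity_Ioi :
    IntegrableOn (densityRatio horizonFreeDensity 1) (Ioi 1) := by
  have := densityConst_pos
  have hrpow : IntegrableOn (fun x : ℝ ↦ x ^ (-3 / 2 : ℝ)) (Ioi 1) :=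
    integrableOn_Ioi_rpow_of_lt (by norm_num) one_pos
  refine ((hrpow.const_mul ((π + 1) * (2 * π) ^ 3)).const_mul (32 * π / densityConst)).mono'
    (measurable_densityRatio measurable_horizonFreeDensity 1).aestronglyMeasurable ?_
  filter_upwards [ae_restrict_mem measurableSet_Ioi] with x hx
  have hx_pos : 0 < x := one_pos.trans hx
  rw [norm_of_nonneg (densityRatio_nonneg horizonFreeDensity_nonneg 1 hx_pos.le)]
  exact (densityRatio_horizonFreeDensity_le hx_pos).trans
    (mul_le_mul_of_nonneg_left (add_rpow_div_quarticFactor_le (mem_Ioi.1 hx).le) (by positivity))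

lemma integrable_densityRatio_horizonFreeDensity :
    Integrable (densityRatio horizonFreeDensity 1) := by
  refine integrable_of_integrableOn_Ioi (c := -1) ?_ fun x ↦ ?_
  · rw [← Ioc_union_Ioi_eq_Ioi zero_le_one]
    exact integrableOn_densityRatio_horizonFreeDensity_Ioc.union
      integrableOn_densityRatio_horizonFreeDensity_Ioi
  · rw [densityRatio_odd horizonFreeDensity_even, neg_one_smul]

/-- The increasing function `1 / log log (π + x^{-1/2})` on the positive half line, extended
continuously by `0`, whose derivative dominates the density. -/
noncomputable def densityPrimitive : ℝ → ℝ :=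
  update (fun x ↦ (log (logFactor x))⁻¹) 0 0

/-- The derivative of `densityPrimitive` on the positive half line. -/
noncomputable def densityMajorant (x : ℝ) : ℝ :=
  1 / 2 * x ^ (-3 / 2 : ℝ) / ((π + x ^ (-1 / 2 : ℝ)) * logWeight x)

lemma densityPrimitive_eventuallyEq {x : ℝ} (hx : 0 < x) :
    densityPrimitive =ᶠ[𝓝 x] fun y ↦ (log (log (π + y ^ (-1 / 2 : ℝ))))⁻¹ := by
  filter_upwards [lt_mem_nhds hx] with y hy
  rw [densityPrimitive, update_of_ne hy.ne', logFactor_of_pos hy]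

lemma hasDerivAt_densityPrimitive {x : ℝ} (hx : 0 < x) :
    HasDerivAt densityPrimitive (densityMajorant x) x := by
  have hfactor := logFactor_pos x
  have hlog := log_logFactor_pos x
  have hweight : logWeight x = logFactor x * log (logFactor x) ^ 2 := rfl
  rw [logFactor_of_pos hx] at hfactor hlog hweight
  have hrpow := (hasDerivAt_rpow_const (p := (-1 / 2 : ℝ)) (Or.inl hx.ne')).const_add π
  refine ((((hrpow.log (by positivity)).log hfactor.ne').fun_inv hlog.ne').congr_of_eventuallyEq
    (densityPrimitive_eventuallyEq hx)).congr_deriv ?_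
  rw [densityMajorant, hweight, show (-1 / 2 - 1 : ℝ) = -3 / 2 by norm_num]
  field_simp

lemma tendsto_densityPrimitive_atTop :
    Tendsto densityPrimitive atTop (𝓝 (log (log π))⁻¹) := by
  have hrpow : Tendsto (fun x : ℝ ↦ π + x ^ (-1 / 2 : ℝ)) atTop (𝓝 π) := by
    simpa only [neg_div, add_zero] using
      (tendsto_rpow_neg_atTop (one_half_pos (α := ℝ))).const_add π
  have hloglog : log (log π) ≠ 0 := by linarith [one_div_twelve_le_log_log_pi]
  refine (((hrpow.log pi_pos.ne').log log_pi_pos.ne').inv₀ hloglog).congr' ?_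
  filter_upwards [eventually_gt_atTop 0] with x hx
  exact (densityPrimitive_eventuallyEq hx).eq_of_nhds.symm

lemma continuousWithinAt_densityPrimitive : ContinuousWithinAt densityPrimitive (Ici 0) 0 := by
  rw [← Ioi_insert, continuousWithinAt_insert_self, ContinuousWithinAt, densityPrimitive,
    update_self]
  have hsum : Tendsto (fun x : ℝ ↦ π + x ^ (-1 / 2 : ℝ)) (𝓝[>] 0) atTop :=
    tendsto_atTop_add_const_left _ _ (tendsto_rpow_neg_nhdsGT_zero (by norm_num))
  refine (tendsto_inv_atTop_zero.comp (tendsto_log_atTop.comp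
    (tendsto_log_atTop.comp hsum))).congr' ?_
  filter_upwards [self_mem_nhdsWithin] with x hx
  exact (densityPrimitive_eventuallyEq hx).eq_of_nhds.symm

lemma densityMajorant_nonneg {x : ℝ} (hx : 0 ≤ x) : 0 ≤ densityMajorant x := by
  have := logWeight_pos x
  unfold densityMajorant
  positivity

lemma integrableOn_densityMajorant : IntegrableOn densityMajorant (Ioi 0) :=
  integrableOn_Ioi_deriv_of_nonneg continuousWithinAt_densityPrimitive
    (fun _ hx ↦ hasDerivAt_densityPrimitive hx) (fun _ hx ↦ densityMajorant_nonneg hx.out.le)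
    tendsto_densityPrimitive_atTop

lemma integral_densityMajorant : ∫ x in Ioi 0, densityMajorant x = (log (log π))⁻¹ := by
  rw [integral_Ioi_of_hasDerivAt_of_nonneg continuousWithinAt_densityPrimitive
    (fun _ hx ↦ hasDerivAt_densityPrimitive hx) (fun _ hx ↦ densityMajorant_nonneg hx.out.le)
    tendsto_densityPrimitive_atTop, densityPrimitive, update_self, sub_zero]

lemma horizonFreeDensity_le {x : ℝ} (hx : 0 < x) :
    horizonFreeDensity x ≤ 2 * densityConst * (1 + 2 * π ^ 2) * densityMajorant x := by
  have hquartic := quarticFactor_pos x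
  have hweight := logWeight_pos x
  have hconst := densityConst_pos
  have := sqrt_pos.2 hx
  have hmajorant : 2 * densityConst * (1 + 2 * π ^ 2) * densityMajorant x =
      densityConst * (1 + 2 * π ^ 2) / (√x ^ 2 * (π * √x + 1) * logWeight x) := by
    rw [densityMajorant, rpow_neg_half_eq_inv_sqrt hx.le,
      rpow_neg_three_halves_eq_inv_sqrt_pow hx.le]
    field_simp
  have hsum : π * √x + 1 ≤ (1 + 2 * π ^ 2) * quarticFactor x := by
    nlinarith [sqrt_le_quarticFactor hx.le, one_le_quarticFactor x, pi_pos]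
  rw [horizonFreeDensity_eq, abs_of_pos hx, hmajorant, sq_sqrt hx.le,
    div_le_div_iff₀ (by positivity) (by positivity)]
  calc densityConst * (x * (π * √x + 1) * logWeight x)
      ≤ densityConst * (x * ((1 + 2 * π ^ 2) * quarticFactor x) * logWeight x) := by gcongr
    _ = densityConst * (1 + 2 * π ^ 2) * (x * quarticFactor x * logWeight x) := by ring

lemma integrable_horizonFreeDensity : Integrable horizonFreeDensity := by
  refine integrable_of_integrableOn_Ioi (c := 1) ?_ fun x ↦ by
    rw [horizonFreeDensity_even, one_smul]
  refine (integrableOn_densityMajorant.const_mul (2 * densityConst * (1 + 2 * π ^ 2))).mono'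
    measurable_horizonFreeDensity.aestronglyMeasurable ?_
  filter_upwards [ae_restrict_mem measurableSet_Ioi] with x hx
  rw [norm_of_nonneg (horizonFreeDensity_nonneg x)]
  exact horizonFreeDensity_le hx

lemma integral_horizonFreeDensity_le : ∫ ω, horizonFreeDensity ω ≤ 1 + 2 * π ^ 2 := by
  have hfold : ∫ ω, horizonFreeDensity ω = 2 * ∫ ω in Ioi 0, horizonFreeDensity ω := by
    rw [← integral_comp_abs]
    simp only [horizonFreeDensity, abs_abs]
  have hhalf : ∫ ω in Ioi 0, horizonFreeDensity ω ≤
      2 * densityConst * (1 + 2 * π ^ 2) * (log (log π))⁻¹ := by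
    rw [← integral_densityMajorant, ← integral_const_mul]
    exact setIntegral_mono_on integrable_horizonFreeDensity.integrableOn
      (integrableOn_densityMajorant.const_mul _) measurableSet_Ioi fun x hx ↦
        horizonFreeDensity_le hx
  have hloglog : log (log π) ≠ 0 := by linarith [one_div_twelve_le_log_log_pi]
  calc ∫ ω, horizonFreeDensity ω
      ≤ 2 * (2 * densityConst * (1 + 2 * π ^ 2) * (log (log π))⁻¹) := by
        rw [hfold]
        exact mul_le_mul_of_nonneg_left hhalf zero_le_two
    _ = 1 + 2 * π ^ 2 := by
        rw [densityConst]
        field_simp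
        norm_num

lemma isSpectralDensity_horizonFreeDensity : IsSpectralDensity horizonFreeDensity where
  integrable := integrable_horizonFreeDensity
  even := horizonFreeDensity_even
  nonneg := horizonFreeDensity_nonneg
  pos _ := horizonFreeDensity_pos

/-! ### The mass of the sine transform of the dual weight -/

section SinePrimitiveMass

variable {V : ℝ → ℝ} {a : ℝ}

lemma integrable_mul_sinePrimitive (hV : Integrable V) (a : ℝ) :
    Integrable fun x ↦ V x * sinePrimitive a x :=
  hV.mul_bdd (continuous_sinePrimitive a).aestronglyMeasurable
    (.of_forall (abs_sinePrimitive_le a))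

lemma setIntegral_Ioc_mul_sinePrimitive_le_of_le_rpow (hV : Integrable V) (ha : 0 < a) {K : ℝ}
    (hK : 0 ≤ K) (h : ∀ x ∈ Ioc 0 a⁻¹, V x ≤ K * (x / a⁻¹) ^ (-3 / 2 : ℝ)) :
    ∫ x in Ioc 0 a⁻¹, V x * sinePrimitive a x ≤ 2 * π * K := by
  have ha_inv : 0 < a⁻¹ := inv_pos.2 ha
  have hrpow : IntegrableOn (fun x : ℝ ↦ x ^ (-1 / 2 : ℝ)) (Ioc 0 a⁻¹) :=
    (intervalIntegrable_iff_integrableOn_Ioc_of_le ha_inv.le).1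
      (intervalIntegral.intervalIntegrable_rpow' (by norm_num))
  have hbound : ∀ x ∈ Ioc 0 a⁻¹,
      V x * sinePrimitive a x ≤ K * π * a ^ (1 / 2 : ℝ) * x ^ (-1 / 2 : ℝ) := by
    rintro x ⟨hx, hxa⟩
    calc V x * sinePrimitive a x
        ≤ K * (x / a⁻¹) ^ (-3 / 2 : ℝ) * (π * a ^ 2 * x) :=
          mul_le_mul (h x ⟨hx, hxa⟩) (sinePrimitive_le_mul a hx) (sinePrimitive_nonneg a hx.le)
            (by positivity)
      _ = K * π * (a ^ (-3 / 2 : ℝ) * a ^ 2) * (x ^ (-3 / 2 : ℝ) * x) := by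
          rw [div_inv_eq_mul, mul_rpow hx.le ha.le]
          ring
      _ = K * π * a ^ (1 / 2 : ℝ) * x ^ (-1 / 2 : ℝ) := by
          rw [← rpow_add_one hx.ne', ← rpow_add_natCast ha.ne']
          norm_num
  calc ∫ x in Ioc 0 a⁻¹, V x * sinePrimitive a x
      ≤ ∫ x in Ioc 0 a⁻¹, K * π * a ^ (1 / 2 : ℝ) * x ^ (-1 / 2 : ℝ) :=
        setIntegral_mono_on (integrable_mul_sinePrimitive hV a).integrableOn (hrpow.const_mul _)
          measurableSet_Ioc hbound
    _ = 2 * π * K := by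
        rw [integral_const_mul, ← intervalIntegral.integral_of_le ha_inv.le,
          integral_rpow (Or.inl (by norm_num)), show (-1 / 2 + 1 : ℝ) = 1 / 2 by norm_num,
          zero_rpow (by norm_num), inv_rpow ha.le]
        field_simp
        ring

lemma setIntegral_Ioc_mul_sinePrimitive_le_of_le (hV : Integrable V) (ha : 1 ≤ a) {K : ℝ}
    (hK : 0 ≤ K) (h : ∀ x ∈ Ioc a⁻¹ 1, V x ≤ K) :
    ∫ x in Ioc a⁻¹ 1, V x * sinePrimitive a x ≤ K * log a / π := by
  have ha_inv : 0 < a⁻¹ := inv_pos.2 (one_pos.trans_le ha)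
  have hle : a⁻¹ ≤ 1 := inv_le_one_of_one_le₀ ha
  have hinv : IntegrableOn (fun x : ℝ ↦ x⁻¹) (Ioc a⁻¹ 1) := by
    rw [← intervalIntegrable_iff_integrableOn_Ioc_of_le hle, intervalIntegrable_inv_iff,
      uIcc_of_le hle]
    exact Or.inr fun hmem ↦ hmem.1.not_gt ha_inv
  calc ∫ x in Ioc a⁻¹ 1, V x * sinePrimitive a x
      ≤ ∫ x in Ioc a⁻¹ 1, K / π * x⁻¹ := by
        refine setIntegral_mono_on (integrable_mul_sinePrimitive hV a).integrableOn
          (hinv.const_mul _) measurableSet_Ioc fun x hx ↦ ?_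
        have hx_pos : 0 < x := ha_inv.trans hx.1
        calc V x * sinePrimitive a x ≤ K * (π * x)⁻¹ :=
              mul_le_mul (h x hx) (sinePrimitive_le_inv a hx_pos)
                (sinePrimitive_nonneg a hx_pos.le) hK
          _ = K / π * x⁻¹ := by field_simp
    _ = K * log a / π := by
        rw [integral_const_mul, ← intervalIntegral.integral_of_le hle,
          integral_inv_of_pos ha_inv one_pos, one_div, inv_inv]
        ring

lemma setIntegral_Ioi_mul_sinePrimitive_le (hV : Integrable V) (a : ℝ) {D : ℝ} (hD : 0 ≤ D)
    (h : ∀ x ∈ Ioi 1, V x ≤ D / x) :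
    ∫ x in Ioi 1, V x * sinePrimitive a x ≤ D / π := by
  have hrpow : IntegrableOn (fun x : ℝ ↦ x ^ (-2 : ℝ)) (Ioi 1) :=
    integrableOn_Ioi_rpow_of_lt (by norm_num) one_pos
  calc ∫ x in Ioi 1, V x * sinePrimitive a x ≤ ∫ x in Ioi 1, D / π * x ^ (-2 : ℝ) := by
        refine setIntegral_mono_on (integrable_mul_sinePrimitive hV a).integrableOn
          (hrpow.const_mul _) measurableSet_Ioi fun x hx ↦ ?_
        have hx_pos : 0 < x := one_pos.trans hx
        calc V x * sinePrimitive a x ≤ D / x * (π * x)⁻¹ :=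
              mul_le_mul (h x hx) (sinePrimitive_le_inv a hx_pos)
                (sinePrimitive_nonneg a hx_pos.le) (by positivity)
          _ = D / π * x ^ (-2 : ℝ) := by
              rw [rpow_neg hx_pos.le, rpow_two]
              field_simp
    _ = D / π := by
        rw [integral_const_mul, integral_Ioi_rpow_of_lt (by norm_num) one_pos]
        norm_num

lemma setIntegral_Ioi_zero_mul_sinePrimitive_le (hV : Integrable V) (ha : 1 ≤ a) {K D : ℝ}
    (hK : 0 ≤ K) (hD : 0 ≤ D) (hlow : ∀ x ∈ Ioc 0 a⁻¹, V x ≤ K * (x / a⁻¹) ^ (-3 / 2 : ℝ))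
    (hmid : ∀ x ∈ Ioc a⁻¹ 1, V x ≤ K) (hhigh : ∀ x ∈ Ioi 1, V x ≤ D / x) :
    ∫ x in Ioi 0, V x * sinePrimitive a x ≤ 2 * π * K + K * log a / π + D / π := by
  have ha_pos : 0 < a := one_pos.trans_le ha
  have hint (s : Set ℝ) : IntegrableOn (fun x ↦ V x * sinePrimitive a x) s :=
    (integrable_mul_sinePrimitive hV a).integrableOn
  rw [← Ioc_union_Ioi_eq_Ioi (inv_pos.2 ha_pos).le,
    setIntegral_union Ioc_disjoint_Ioi_same measurableSet_Ioi (hint _) (hint _),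
    ← Ioc_union_Ioi_eq_Ioi (inv_le_one_of_one_le₀ ha),
    setIntegral_union Ioc_disjoint_Ioi_same measurableSet_Ioi (hint _) (hint _), ← add_assoc]
  exact add_le_add (add_le_add (setIntegral_Ioc_mul_sinePrimitive_le_of_le_rpow hV ha_pos hK hlow)
    (setIntegral_Ioc_mul_sinePrimitive_le_of_le hV ha hK hmid))
    (setIntegral_Ioi_mul_sinePrimitive_le hV a hD hhigh)

end SinePrimitiveMass

lemma dualWeight_horizonFreeDensity {x : ℝ} (hx : 0 < x) : dualWeight horizonFreeDensity x =
    logWeight x / densityConst * (quarticFactor x / (1 + 4 * π ^ 2 * x ^ 2)) := by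
  have := quarticFactor_pos x
  have := logWeight_pos x
  have := densityConst_pos
  rw [dualWeight, horizonFreeDensity_eq, abs_of_pos hx]
  field_simp

lemma dualWeight_horizonFreeDensity_le {x : ℝ} (hx : 0 < x) :
    dualWeight horizonFreeDensity x ≤ logWeight x / densityConst := by
  have hnonneg : 0 ≤ logWeight x / densityConst :=
    (div_pos (logWeight_pos x) densityConst_pos).le
  rw [dualWeight_horizonFreeDensity hx]
  refine mul_le_of_le_one_right hnonneg ?_
  calc quarticFactor x / (1 + 4 * π ^ 2 * x ^ 2)
      ≤ quarticFactor x ^ 4 / (1 + 4 * π ^ 2 * x ^ 2) := by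
        gcongr
        exact le_self_pow₀ (one_le_quarticFactor x) four_ne_zero
    _ = lorentzianRatio x := by rw [quarticFactor_pow_four, lorentzianRatio]
    _ ≤ 1 := lorentzianRatio_le_one x

lemma dualWeight_horizonFreeDensity_le_div {x : ℝ} (hx : 1 ≤ x) :
    dualWeight horizonFreeDensity x ≤ logWeight x / densityConst / (2 * π ^ 2) / x := by
  have hx_pos : 0 < x := one_pos.trans_le hx
  have := div_pos (logWeight_pos x) densityConst_pos
  calc dualWeight horizonFreeDensity x
      = logWeight x / densityConst * (quarticFactor x / (1 + 4 * π ^ 2 * x ^ 2)) :=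
        dualWeight_horizonFreeDensity hx_pos
    _ ≤ logWeight x / densityConst * (2 * x / (4 * π ^ 2 * x ^ 2)) := by
        gcongr
        · exact quarticFactor_le_two_mul hx
        · exact le_add_of_nonneg_left zero_le_one
    _ = logWeight x / densityConst / (2 * π ^ 2) / x := by
        field_simp
        norm_num

lemma integral_dualWeight_mul_sinePrimitive_le {a : ℝ} (ha : 1 ≤ a) :
    ∫ x in Ioi 0, dualWeight horizonFreeDensity x * sinePrimitive a x ≤
      logWeight a⁻¹ / densityConst * (2 * π + log a / π + 1 / (2 * π ^ 3)) := by
  have hconst := densityConst_pos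
  have ha_inv : a⁻¹ ∈ Ioi 0 := inv_pos.2 (one_pos.trans_le ha)
  have hK := div_pos (logWeight_pos a⁻¹) hconst
  have hanti {x : ℝ} (hx : a⁻¹ ≤ x) : logWeight x / densityConst ≤ logWeight a⁻¹ / densityConst :=
    div_le_div_of_nonneg_right (antitoneOn_logWeight ha_inv (ha_inv.out.trans_le hx) hx) hconst.le
  have hmass := setIntegral_Ioi_zero_mul_sinePrimitive_le (K := logWeight a⁻¹ / densityConst)
    (D := logWeight a⁻¹ / densityConst / (2 * π ^ 2))
    (integrable_dualWeight integrable_densityRatio_horizonFreeDensity) ha hK.le (by positivity)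
    (fun x hx ↦ ?_)
    (fun x hx ↦ (dualWeight_horizonFreeDensity_le (ha_inv.out.trans hx.1)).trans (hanti hx.1.le))
    (fun x hx ↦ ?_)
  · refine hmass.trans_eq ?_
    field_simp
  · refine (dualWeight_horizonFreeDensity_le hx.1).trans ?_
    rw [div_mul_eq_mul_div, mul_comm (logWeight a⁻¹)]
    exact div_le_div_of_nonneg_right (logWeight_le_rpow_mul hx.1 hx.2) hconst.le
  · have hx_one : 1 ≤ x := hx.out.le
    have := hanti ((inv_le_one_of_one_le₀ ha).trans hx_one)
    refine (dualWeight_horizonFreeDensity_le_div hx_one).trans ?_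
    gcongr

lemma two_div_pi_mul_le {l : ℝ} (hl : 12 / 11 ≤ l) :
    2 / π * (2 * π + l / π + 1 / (2 * π ^ 3)) ≤ 5 * l := by
  have hsq : 9 ≤ π ^ 2 := by nlinarith [pi_gt_three]
  have hinv_sq : 1 / π ^ 2 ≤ 1 / 9 := one_div_le_one_div_of_le (by norm_num) hsq
  have hinv_four : 1 / π ^ 4 ≤ 1 / 9 := one_div_le_one_div_of_le (by norm_num) (by nlinarith)
  calc 2 / π * (2 * π + l / π + 1 / (2 * π ^ 3)) = 4 + 2 * l * (1 / π ^ 2) + 1 / π ^ 4 := by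
        field_simp
        ring
    _ ≤ 5 * l := by nlinarith

lemma sixteen_le_two_mul_pi_mul_exp_one : 16 ≤ 2 * π * exp 1 := by
  nlinarith [pi_gt_three, exp_one_gt_d9]

lemma integral_abs_sineTransform_dualWeight_le {a : ℝ} (ha : 3 ≤ a) :
    (2 * π)⁻¹ * ∫ z in (-a)..a, |sineTransform (dualWeight horizonFreeDensity) z| ≤
      ((2 * π * exp 1) ^ 2) ^ 2 * (log a * log (log a)) ^ 2 := by
  have hlog := twelve_div_eleven_le_log ha
  have hconst := densityConst_pos
  have hconst_inv : densityConst⁻¹ ≤ 48 :=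
    inv_le_of_inv_le₀ (by norm_num) (by linarith [one_div_forty_eight_le_densityConst])
  have hweight := logWeight_pos a⁻¹
  rw [integral_abs_sineTransform (integrable_dualWeight integrable_densityRatio_horizonFreeDensity)
    (dualWeight_odd horizonFreeDensity_even) (antitoneOn_dualWeight horizonFreeDensity_nonneg
      antitoneOn_densityRatio_horizonFreeDensity) (by linarith)]
  calc (2 * π)⁻¹ *
        (4 * ∫ x in Ioi 0, dualWeight horizonFreeDensity x * sinePrimitive a x)
      ≤ (2 * π)⁻¹ *
        (4 * (logWeight a⁻¹ / densityConst * (2 * π + log a / π + 1 / (2 * π ^ 3)))) := by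
        gcongr
        exact integral_dualWeight_mul_sinePrimitive_le (by linarith)
    _ = densityConst⁻¹ * logWeight a⁻¹ *
        (2 / π * (2 * π + log a / π + 1 / (2 * π ^ 3))) := by
        field_simp
        ring
    _ ≤ 48 * (2 * log a * (10 * log (log a)) ^ 2) * (5 * log a) :=
        mul_le_mul (mul_le_mul hconst_inv (logWeight_inv_le ha) hweight.le (by norm_num))
          (two_div_pi_mul_le hlog) (by positivity) (by positivity)
    _ ≤ (16 ^ 2) ^ 2 * (log a * log (log a)) ^ 2 := by
        linarith [sq_nonneg (log a * log (log a))]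
    _ ≤ ((2 * π * exp 1) ^ 2) ^ 2 * (log a * log (log a)) ^ 2 := by
        gcongr
        exact sixteen_le_two_mul_pi_mul_exp_one

lemma spectralNormSq_horizonFreeDensity_le {T : ℝ} (hT : 2 < T) {f : ℝ → ℝ}
    (hf : TwiceDifferentiable f) (hs : support f ⊆ Icc 0 (T + 1)) :
    spectralNormSq horizonFreeDensity f ≤
      ENNReal.ofReal (((2 * π * exp 1) ^ 2) ^ 2) * eLpNorm (deriv f) 1 volume *
        eLpNorm (fun t ↦ f t - deriv (deriv f) t) ∞ volume *
        ENNReal.ofReal ((log (1 + T) * log (log (1 + T))) ^ 2) := by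
  have ha : 3 ≤ 1 + T := by linarith
  have hlog := twelve_div_eleven_le_log ha
  have hloglog : 0 < log (log (1 + T)) := by linarith [one_div_twelve_le_log hlog]
  have hM_pos : 0 < ((2 * π * exp 1) ^ 2) ^ 2 * (log (1 + T) * log (log (1 + T))) ^ 2 := by
    have : 0 < log (1 + T) := by linarith
    positivity
  rw [add_comm T] at hs
  refine (hf.spectralNormSq_le_eLpNorm hs isSpectralDensity_horizonFreeDensity
    (integrable_dualWeight integrable_densityRatio_horizonFreeDensity) hM_pos ?_).trans_eq ?_
  · rw [zero_sub, sub_zero]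
    exact integral_abs_sineTransform_dualWeight_le ha
  · rw [ENNReal.ofReal_mul (by positivity)]
    ring

theorem mainTheorem4 :
    -- the density and the function `R` (order `m = 1`) satisfy the requirements
    (∀ ω, 0 ≤ horizonFreeDensity ω) ∧
    (∀ ω, ω ≠ 0 → 0 < horizonFreeDensity ω) ∧
    (∀ ω, horizonFreeDensity (-ω) = horizonFreeDensity ω) ∧
    Integrable horizonFreeDensity ∧
    Integrable (densityRatio horizonFreeDensity 1) ∧
    AntitoneOn (densityRatio horizonFreeDensity 1) (Set.Ioi 0) ∧
    -- `k` is a real, positive semidefinite, translation invariant, universal kernel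
    (∀ s t, (spectralKernelC horizonFreeDensity s t).im = 0) ∧
    (Matrix.of (spectralKernel horizonFreeDensity)).PosSemidef ∧
    IsTranslationInvariant (spectralKernel horizonFreeDensity) ∧
    IsUniversalKernel (spectralKernel horizonFreeDensity) ∧
    -- with bounded diagonal
    (∀ t, spectralKernel horizonFreeDensity t t ≤ 8 * Real.pi ^ 2) ∧
    -- its RKHS contains the compactly supported functions with bounded derivatives up to order two,
    -- and there its norm is given by the spectral formula
    (∀ (H : Type*) [NormedAddCommGroup H] [InnerProductSpace ℝ H] [CompleteSpace H]
        [RKHS ℝ H ℝ ℝ],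
      HasReproducingKernel H (spectralKernel horizonFreeDensity) →
      ∀ f : ℝ → ℝ, TwiceDifferentiable f → HasCompactSupport f →
        (∃ C : ℝ, ∀ t, |deriv (deriv f) t| ≤ C) →
        ∃ g : H, (⇑g : ℝ → ℝ) = f ∧
          ENNReal.ofReal (‖g‖ ^ 2) = spectralNormSq horizonFreeDensity f) ∧
    -- the bound, in the RKHS norm and in the norm given by the spectral formula
    (∃ c : ℝ, 0 ≤ c ∧ c ≤ (2 * Real.pi * Real.exp 1) ^ 2 ∧
      ∀ (T : ℝ), 2 < T → ∀ f : ℝ → ℝ, TwiceDifferentiable f →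
        Function.support f ⊆ Set.Icc 0 (T + 1) →
        spectralNormSq horizonFreeDensity f ≤
          ENNReal.ofReal (c ^ 2) * eLpNorm (deriv f) 1 volume *
            eLpNorm (fun t => f t - deriv (deriv f) t) ∞ volume *
            ENNReal.ofReal ((Real.log (1 + T) * Real.log (Real.log (1 + T))) ^ 2) ∧
        ∀ (H : Type*) [NormedAddCommGroup H] [InnerProductSpace ℝ H] [CompleteSpace H]
            [RKHS ℝ H ℝ ℝ],
          HasReproducingKernel H (spectralKernel horizonFreeDensity) →
          rkhsNormSq H f ≤
            ENNReal.ofReal (c ^ 2) * eLpNorm (deriv f) 1 volume *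
              eLpNorm (fun t => f t - deriv (deriv f) t) ∞ volume *
              ENNReal.ofReal ((Real.log (1 + T) * Real.log (Real.log (1 + T))) ^ 2)) := by
  have hQ := isSpectralDensity_horizonFreeDensity
  have hR := integrable_densityRatio_horizonFreeDensity
  have hV := integrable_dualWeight hR
  refine ⟨hQ.nonneg, hQ.pos, hQ.even, hQ.integrable, hR, antitoneOn_densityRatio_horizonFreeDensity,
    hQ.spectralKernelC_im, hQ.posSemidef, isTranslationInvariant_spectralKernel _, ?universal,
    ?diagonal, ?norm, (2 * π * exp 1) ^ 2, sq_nonneg _, le_rfl, ?bound⟩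
  case universal =>
    exact hQ.isUniversalKernel fun f hf hc ↦ spectralNormSq_ne_top_of_contDiff hf hc hQ hV
  case diagonal =>
    intro t
    rw [hQ.spectralKernel_self]
    linarith [integral_horizonFreeDensity_le, one_le_four_mul_pi_sq]
  case norm =>
    rintro H _ _ _ _ hH f hf hc ⟨C, hC⟩
    have h2 := integrable_deriv_deriv_of_ae_le hc (.of_forall hC)
    exact hQ.exists_rkhs_norm_eq hf.1.continuous (hf.integrable hc)
      (hf.spectralNormSq_ne_top hc h2 hQ hV) hH
  case bound =>
    intro T hT f hf hs
    have hbound := spectralNormSq_horizonFreeDensity_le hT hf hs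
    have hc : HasCompactSupport f := .of_support_subset_isCompact isCompact_Icc hs
    exact ⟨hbound, fun H _ _ _ _ hH ↦
      (hQ.rkhsNormSq_le_spectralNormSq hf.1.continuous (hf.integrable hc) hH).trans hbound⟩
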